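/- Let $\{Z_k : k\ge 1\}$ be a centered stationary Gaussian sequence on a probability space $(\Omega,\mathcal F,\mathbb P)$, with covariance function $r(k)=\mathbb E[Z_nZ_{n+k}]$, $k\ge 0$. Put $X_n=\sum_{k=1}^n Z_k$ and $g(n)=\sqrt{\mathbb E[X_n^2]}$. A measurable function $L$, positive near infinity, is called slowly varying if $\lim_{x\to\infty}L(cx)/L(x)=1$ for every $c>0$. The law of the iterated logarithm $$\limsup_{n\to\infty}\frac{X_n}{\sqrt{2g(n)^2\log\log n}}=1\qquad \mathbb P\text{-almost surely}\tag{LIL}$$ holds in each of the following two cases. (i) $g(n)\sim n^aL(n)$ as $n\to\infty$ for some $a\in(0,1)$ and some slowly varying $L$, and $r(k)=O\big(k^{-(2-2a)}\big)$ as $k\to\infty$. (ii) $\sum_{k=1}^\infty|r(k)|<\infty$ and, in addition, either $r(0)+2\sum_{k=1}^\infty r(k)>0$ or, more generally, $g(n)\sim n^{a}L(n)$ for some $a\in(0,1)$ and some slowly varying $L$. -/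

import Mathlib

open MeasureTheory ProbabilityTheory Filter Topology Asymptotics

namespace GaussianLIL

noncomputable section

/-- A slowly varying function: measurable, positive near infinity, and
`L (c x) / L x → 1` as `x → ∞` for every `c > 0`. -/
structure IsSlowlyVarying (L : ℝ → ℝ) : Prop where
  measurable : Measurable L
  eventually_pos : ∀ᶠ x in atTop, 0 < L x
  tendsto_ratio : ∀ c : ℝ, 0 < c → Tendsto (fun x : ℝ => L (c * x) / L x) atTop (𝓝 1)

variable {Ω : Type*} [MeasurableSpace Ω]

/-- The covariance function `r k = 𝔼[Z_n Z_{n+k}]` of a stationary centered sequence; the value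
does not depend on `n` by stationarity, so the first index is used. -/
def corr (P : Measure Ω) (Z : ℕ → Ω → ℝ) (k : ℕ) : ℝ :=
  ∫ ω, Z 0 ω * Z k ω ∂P

/-- A centered stationary Gaussian sequence. The index `k : ℕ` stands for the `(k+1)`-st variable
of the sequence, so the sequence `Z_1, Z_2, …` is `Z 0, Z 1, …`. For a centered Gaussian sequence,
invariance of the covariances under shifts is the same as invariance of the law under shifts. -/
structure IsCenteredStationaryGaussian (P : Measure Ω) (Z : ℕ → Ω → ℝ) : Prop where
  gaussian : IsGaussianProcess Z P
  centered : ∀ k, ∫ ω, Z k ω ∂P = 0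
  stationary : ∀ n k, ∫ ω, Z n ω * Z (n + k) ω ∂P = corr P Z k

/-- The partial sum `X_n` of the first `n` variables. -/
def partialSum (Z : ℕ → Ω → ℝ) (n : ℕ) (ω : Ω) : ℝ :=
  ∑ k ∈ Finset.range n, Z k ω

/-- `g n = √(𝔼[X_n ^ 2])`. -/
def stdDev (P : Measure Ω) (Z : ℕ → Ω → ℝ) (n : ℕ) : ℝ :=
  Real.sqrt (∫ ω, (partialSum Z n ω) ^ 2 ∂P)

/-- `limsup X_n / √(2 g(n)² log log n) = 1` almost surely, the upper limit being taken in the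
extended reals. -/
def LIL (P : Measure Ω) (Z : ℕ → Ω → ℝ) : Prop :=
  ∀ᵐ ω ∂P, limsup (fun n : ℕ =>
    ((partialSum Z n ω / Real.sqrt (2 * (stdDev P Z n) ^ 2 * Real.log (Real.log (n : ℝ))) : ℝ) :
      EReal)) atTop = 1

end

end GaussianLIL

namespace GaussianLIL

open scoped RealInnerProductSpace ENNReal

/-! ### Dyadic decomposition of windows. -/

section

/-! Both cases reduce to one fact: if `g` is regularly varying with index in `(0, 1)`, the LIL
holds. Absolutely summable correlations with positive long-run variance give `g(n) ~ c √n` by a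
Cesàro argument, hence index `1/2`. In `L²` the sequence becomes a shift-invariant sequence of
vectors, and `g(n)` is the norm of its `n`-th partial sum. Since `0 < a < 1`, along powers of two
`g` eventually grows at each step by a factor between `κ⁻¹` and `2κ` for some `κ < 1`.

Upper half: Borel–Cantelli gives the sharp constant on a grid of boundedly many points in each block
`[2^p, 2^(p+1))`. A point off the grid differs from one on it by a short window, which binary
expansion splits into dyadic windows. The cruder bound of `ae_eventually_dyadic` on these, weighted
by `κ^e` at depth `e`, sums to a small fraction of `√(log p) g(n)`;
`IsRegVarNorm.eventually_windowSum_le` combines the two.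

Lower half: averaging over shifts (`abs_inner_windowSum_le`) makes the correlation of `X` at times
`2^p` and `2^(p+2d)` at most a constant times `κ^d`. Along a sparse geometric subsequence the
normalized sums are therefore almost orthonormal. Each has a small projection on its predecessors,
and the residuals are orthogonal, hence independent. The second Borel–Cantelli lemma makes the
residuals large infinitely often, while the first keeps the projections small
(`ae_frequently_of_almost_orthonormal`). -/

/-- The sum of the `n` consecutive terms of a sequence that start at index `b`. -/
def windowSum {M : Type*} [AddCommMonoid M] (z : ℕ → M) (b n : ℕ) : M :=
  ∑ i ∈ Finset.range n, z (b + i)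

theorem windowSum_add {M : Type*} [AddCommMonoid M] (z : ℕ → M) (b m n : ℕ) :
    windowSum z b (m + n) = windowSum z b m + windowSum z (b + m) n := by
  simp [windowSum, Finset.sum_range_add, add_assoc]

@[simp] theorem windowSum_zero {M : Type*} [AddCommMonoid M] (z : ℕ → M) (b : ℕ) :
    windowSum z b 0 = 0 := by simp [windowSum]

/-- Both sides sum `z (i + l)` over the rectangle `i < s`, `l < m`. This turns an average of short
windows into a sum of few longer ones. -/
theorem sum_windowSum_comm {M : Type*} [AddCommMonoid M] (z : ℕ → M) (m s : ℕ) :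
    ∑ i ∈ Finset.range s, windowSum z i m = ∑ l ∈ Finset.range m, windowSum z l s := by
  simp only [windowSum]
  rw [Finset.sum_comm]
  simp [add_comm]

/-- Binary expansion of the length of a window: a window that starts at a multiple of `2 ^ q` and
is shorter than `2 ^ q` is made of at most one dyadic window of each length `2 ^ i`, `i < q`. -/
theorem abs_windowSum_le_sum_dyadic {x : ℕ → ℝ} {B : ℕ → ℝ} {lo hi q : ℕ} (hB : ∀ i, 0 ≤ B i)
    (h : ∀ i < q, ∀ t, lo ≤ t * 2 ^ i → t * 2 ^ i < hi →
      |windowSum x (t * 2 ^ i) (2 ^ i)| ≤ B i)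
    {b m : ℕ} (hb : 2 ^ q ∣ b) (hlo : lo ≤ b) (hhi : b + m < hi) (hm : m < 2 ^ q) :
    |windowSum x b m| ≤ ∑ i ∈ Finset.range q, B i := by
  induction q generalizing b m with
  | zero =>
    obtain rfl : m = 0 := by simpa using hm
    simp
  | succ q ih =>
    have hbq : 2 ^ q ∣ b := (pow_dvd_pow 2 q.le_succ).trans hb
    have h' := fun i (hi' : i < q) => h i (hi'.trans q.lt_succ_self)
    rw [Finset.sum_range_succ]
    rcases lt_or_ge m (2 ^ q) with hmq | hmq
    · linarith [ih h' hbq hlo hhi hmq, hB q]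
    · obtain ⟨k, rfl⟩ := Nat.exists_eq_add_of_le hmq
      rw [windowSum_add]
      have h1 := ih h' (b := b + 2 ^ q) (m := k) (dvd_add hbq dvd_rfl) (by omega) (by omega)
        (by rw [pow_succ] at hm; omega)
      obtain ⟨t, rfl⟩ := hbq
      have h2 := h q q.lt_succ_self t (by rwa [mul_comm]) (by rw [mul_comm]; omega)
      rw [mul_comm t] at h2
      linarith [abs_add_le (windowSum x (2 ^ q * t) (2 ^ q)) (windowSum x (2 ^ q * t + 2 ^ q) k)]

/-! ### Shift-invariant sequences in an inner product space. -/

section Stationary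

variable {H : Type*} [NormedAddCommGroup H] [InnerProductSpace ℝ H] {z : ℕ → H}

theorem inner_windowSum_shift (hz : ∀ i j k, ⟪z (i + k), z (j + k)⟫ = ⟪z i, z j⟫)
    (a b m n k : ℕ) :
    ⟪windowSum z (a + k) m, windowSum z (b + k) n⟫ = ⟪windowSum z a m, windowSum z b n⟫ := by
  simp only [windowSum, sum_inner, inner_sum]
  refine Finset.sum_congr rfl fun i _ => Finset.sum_congr rfl fun j _ => ?_
  rw [add_right_comm a, add_right_comm b, hz]

theorem norm_windowSum (hz : ∀ i j k, ⟪z (i + k), z (j + k)⟫ = ⟪z i, z j⟫) (b n : ℕ) :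
    ‖windowSum z b n‖ = ‖windowSum z 0 n‖ := by
  have := inner_windowSum_shift hz 0 0 n n b
  rw [zero_add, real_inner_self_eq_norm_sq, real_inner_self_eq_norm_sq] at this
  exact (sq_eq_sq₀ (norm_nonneg _) (norm_nonneg _)).1 this

/-- Averaging a long window over `s` shifts bounds its inner product with a short window. -/
theorem abs_inner_windowSum_le (hz : ∀ i j k, ⟪z (i + k), z (j + k)⟫ = ⟪z i, z j⟫)
    {m n s : ℕ} (hs : 0 < s) {G : ℝ} (hG : ∀ k ≤ s, ‖windowSum z 0 k‖ ≤ G) :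
    |⟪windowSum z 0 m, windowSum z 0 n⟫| ≤ 2 * G * ‖windowSum z 0 m‖ +
      m / s * ‖windowSum z 0 s‖ * ‖windowSum z 0 n‖ := by
  have hs' : (0 : ℝ) < s := by exact_mod_cast hs
  set x := windowSum z 0 m
  -- For each `i < s`, moving the long window from `0` to `i` changes it by two windows of length
  -- `i`. Shifting the remaining inner product by `s - 1 - i` then makes its long window start at `s
  -- - 1` for every `i`, so that the sum over `i` passes to the short windows.
  have key : s * ⟪x, windowSum z 0 n⟫ =
      ∑ i ∈ Finset.range s, ⟪x, windowSum z 0 i - windowSum z n i⟫ +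
        ⟪∑ l ∈ Finset.range m, windowSum z l s, windowSum z (s - 1) n⟫ := by
    rw [← sum_windowSum_comm, ← Finset.sum_range_reflect (fun i => windowSum z i m), sum_inner, ← Finset.sum_add_distrib]
    have : ∀ i ∈ Finset.range s, ⟪x, windowSum z 0 i - windowSum z n i⟫ +
        ⟪windowSum z (s - 1 - i) m, windowSum z (s - 1) n⟫ = ⟪x, windowSum z 0 n⟫ := by
      intro i hi
      have hi := Finset.mem_range.1 hi
      have h1 := inner_windowSum_shift hz 0 i m n (s - 1 - i)
      rw [zero_add, show i + (s - 1 - i) = s - 1 by omega] at h1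
      rw [h1, ← inner_add_right]
      congr 1
      have h2 := windowSum_add z 0 i n
      have h3 := windowSum_add z 0 n i
      rw [zero_add] at h2 h3
      rw [add_comm i n, h3] at h2
      rw [sub_add_eq_add_sub, ← h2, add_sub_cancel_right]
    rw [Finset.sum_congr rfl this]
    simp
  have h1 : |∑ i ∈ Finset.range s, ⟪x, windowSum z 0 i - windowSum z n i⟫| ≤ s * (‖x‖ * (2 * G)) := by
    refine (Finset.abs_sum_le_sum_abs _ _).trans ?_
    rw [← nsmul_eq_mul, ← Finset.card_range s, Finset.card_range]
    nth_rw 2 [← Finset.card_range s]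
    refine Finset.sum_le_card_nsmul _ _ _ fun i hi => ?_
    refine (abs_real_inner_le_norm _ _).trans ?_
    refine mul_le_mul_of_nonneg_left ?_ (norm_nonneg _)
    refine (norm_sub_le _ _).trans ?_
    rw [norm_windowSum hz n]
    linarith [hG i (Finset.mem_range.1 hi).le]
  have h2 : |⟪∑ l ∈ Finset.range m, windowSum z l s, windowSum z (s - 1) n⟫| ≤
      m * ‖windowSum z 0 s‖ * ‖windowSum z 0 n‖ := by
    refine (abs_real_inner_le_norm _ _).trans ?_
    rw [norm_windowSum hz (s - 1)]
    refine mul_le_mul_of_nonneg_right ?_ (norm_nonneg _)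
    refine (norm_sum_le _ _).trans ?_
    simp [norm_windowSum hz _ s]
  have h3 : s * |⟪x, windowSum z 0 n⟫| ≤
      s * (‖x‖ * (2 * G)) + m * ‖windowSum z 0 s‖ * ‖windowSum z 0 n‖ := by
    rw [← abs_of_pos hs', ← abs_mul, abs_of_pos hs', key]
    exact (abs_add_le _ _).trans (add_le_add h1 h2)
  have h4 : s * (2 * G * ‖x‖ + m / s * ‖windowSum z 0 s‖ * ‖windowSum z 0 n‖) =
      s * (‖x‖ * (2 * G)) + m * ‖windowSum z 0 s‖ * ‖windowSum z 0 n‖ := by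
    field_simp
  exact le_of_mul_le_mul_left (h4 ▸ h3) hs'

end Stationary

/-! ### Regularly varying norms along dyadic scales. -/

/-- The properties of `n ↦ ‖X n‖`, for a regularly varying sequence of norms of the partial sums of
a stationary sequence, that control the sequence along dyadic scales. -/
structure IsRegVarNorm (g : ℕ → ℝ) (a : ℝ) : Prop where
  nonneg : ∀ n, 0 ≤ g n
  zero : g 0 = 0
  add_le : ∀ m n, g (m + n) ≤ g m + g n
  le_add : ∀ m n, g m ≤ g (m + n) + g n
  eventually_pos : ∀ᶠ n in atTop, 0 < g n
  tendsto_ratio : ∀ j : ℕ, 0 < j → Tendsto (fun n => g (j * n) / g n) atTop (𝓝 ((j : ℝ) ^ a))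

namespace IsRegVarNorm

variable {g : ℕ → ℝ} {a : ℝ}

/-- Binary expansion of `m` and subadditivity. -/
theorem le_sum_dyadic (hg : IsRegVarNorm g a) {q m : ℕ} (hm : m < 2 ^ q) :
    g m ≤ ∑ i ∈ Finset.range q, g (2 ^ i) := by
  induction q generalizing m with
  | zero =>
    obtain rfl : m = 0 := by simpa using hm
    simp [hg.zero]
  | succ q ih =>
    rw [Finset.sum_range_succ]
    rcases lt_or_ge m (2 ^ q) with hmq | hmq
    · linarith [ih hmq, hg.nonneg (2 ^ q)]
    · obtain ⟨k, rfl⟩ := Nat.exists_eq_add_of_le hmq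
      linarith [ih (m := k) (by rw [pow_succ] at hm; omega), hg.add_le (2 ^ q) k]

/-- Potter bounds along dyadic scales, with a common rate `κ`. -/
theorem exists_potter (hg : IsRegVarNorm g a) (ha : 0 < a) (ha' : a < 1) :
    ∃ κ C : ℝ, ∃ p₀ : ℕ, 0 < κ ∧ κ < 1 ∧ 0 < C ∧ (∀ p ≥ p₀, 0 < g (2 ^ p)) ∧
      (∀ p ≥ p₀, ∀ q ≤ p, g (2 ^ q) ≤ C * κ ^ (p - q) * g (2 ^ p)) ∧
      (∀ p ≥ p₀, ∀ i ≥ p, g (2 ^ i) ≤ (2 * κ) ^ (i - p) * g (2 ^ p)) := by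
  have h1 : (2 : ℝ) ^ (-a) < 1 := Real.rpow_lt_one_of_one_lt_of_neg one_lt_two (by linarith)
  have h2 : (2 : ℝ) ^ (a - 1) < 1 := Real.rpow_lt_one_of_one_lt_of_neg one_lt_two (by linarith)
  -- The limiting growth factor `2^a` lies strictly between `κ⁻¹` and `2κ`, so one `κ` serves both
  -- Potter bounds.
  obtain ⟨κ, hκ, hκ1⟩ := exists_between (max_lt h1 h2)
  have hκa := (le_max_left _ _).trans_lt hκ
  have hκb := (le_max_right _ _).trans_lt hκ
  have hκ0 : 0 < κ := lt_trans (by positivity) hκa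
  have hlow : κ⁻¹ < ((2 : ℕ) : ℝ) ^ a := by
    rw [Real.rpow_neg zero_le_two] at hκa
    simpa using inv_lt_of_inv_lt₀ (by positivity) hκa
  have hupp : ((2 : ℕ) : ℝ) ^ a < 2 * κ := by
    rw [Real.rpow_sub_one two_ne_zero] at hκb
    push_cast
    linarith
  have hpow : Tendsto (fun p : ℕ => 2 ^ p) atTop atTop := tendsto_pow_atTop_atTop_of_one_lt one_lt_two
  have hev := hpow.eventually (((hg.tendsto_ratio 2 two_pos).eventually_const_lt hlow).and
    (((hg.tendsto_ratio 2 two_pos).eventually_lt_const hupp).and hg.eventually_pos))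
  obtain ⟨p₀, hp₀⟩ := eventually_atTop.1 hev
  have hpos : ∀ p ≥ p₀, 0 < g (2 ^ p) := fun p hp => (hp₀ p hp).2.2
  have hdn : ∀ p ≥ p₀, g (2 ^ p) ≤ κ * g (2 ^ (p + 1)) := by
    intro p hp
    have := (hp₀ p hp).1
    rw [lt_div_iff₀ (hpos p hp), ← pow_succ'] at this
    rw [← div_le_iff₀' hκ0, div_eq_inv_mul]
    exact this.le
  have hup : ∀ p ≥ p₀, g (2 ^ (p + 1)) ≤ 2 * κ * g (2 ^ p) := by
    intro p hp
    have := (hp₀ p hp).2.1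
    rw [div_lt_iff₀ (hpos p hp), ← pow_succ'] at this
    exact this.le
  have hdn' : ∀ q ≥ p₀, ∀ d, g (2 ^ q) ≤ κ ^ d * g (2 ^ (q + d)) := by
    intro q hq d
    induction d with
    | zero => simp
    | succ d ih =>
      calc g (2 ^ q) ≤ κ ^ d * g (2 ^ (q + d)) := ih
        _ ≤ κ ^ d * (κ * g (2 ^ (q + d + 1))) := by gcongr; exact hdn _ (by omega)
        _ = κ ^ (d + 1) * g (2 ^ (q + (d + 1))) := by rw [← add_assoc]; ring
  have hup' : ∀ q ≥ p₀, ∀ d, g (2 ^ (q + d)) ≤ (2 * κ) ^ d * g (2 ^ q) := by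
    intro q hq d
    induction d with
    | zero => simp
    | succ d ih =>
      calc g (2 ^ (q + (d + 1))) ≤ 2 * κ * g (2 ^ (q + d)) := hup (q + d) (by omega)
        _ ≤ 2 * κ * ((2 * κ) ^ d * g (2 ^ q)) := by gcongr
        _ = (2 * κ) ^ (d + 1) * g (2 ^ q) := by ring
  -- The sum absorbs the finitely many scales below `p₀`, where the ratio limit gives no control.
  set C : ℝ := 1 + ∑ q ∈ Finset.range p₀, g (2 ^ q) / (κ ^ (p₀ - q) * g (2 ^ p₀)) with hC
  have hterm : ∀ q, 0 ≤ g (2 ^ q) / (κ ^ (p₀ - q) * g (2 ^ p₀)) := fun q =>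
    div_nonneg (hg.nonneg _) (mul_nonneg (by positivity) (hg.nonneg _))
  have hC1 : 1 ≤ C := le_add_of_nonneg_right (Finset.sum_nonneg fun q _ => hterm q)
  refine ⟨κ, C, p₀, hκ0, hκ1, by linarith, hpos, ?_, ?_⟩
  · intro p hp q hq
    rcases le_or_gt p₀ q with hq0 | hq0
    · obtain ⟨d, rfl⟩ := Nat.exists_eq_add_of_le hq
      rw [add_tsub_cancel_left]
      calc g (2 ^ q) ≤ 1 * κ ^ d * g (2 ^ (q + d)) := by rw [one_mul]; exact hdn' q hq0 d
        _ ≤ C * κ ^ d * g (2 ^ (q + d)) := by gcongr; exact hg.nonneg _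
    · obtain ⟨d, rfl⟩ := Nat.exists_eq_add_of_le hp
      have hle : g (2 ^ q) / (κ ^ (p₀ - q) * g (2 ^ p₀)) ≤ C := by
        have := Finset.single_le_sum (f := fun q => g (2 ^ q) / (κ ^ (p₀ - q) * g (2 ^ p₀)))
          (fun q _ => hterm q) (Finset.mem_range.2 hq0)
        linarith
      rw [div_le_iff₀ (mul_pos (by positivity) (hpos _ le_rfl))] at hle
      calc g (2 ^ q) ≤ C * (κ ^ (p₀ - q) * g (2 ^ p₀)) := hle
        _ ≤ C * (κ ^ (p₀ - q) * (κ ^ d * g (2 ^ (p₀ + d)))) := by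
          gcongr; exact hdn' p₀ le_rfl d
        _ = C * κ ^ (p₀ + d - q) * g (2 ^ (p₀ + d)) := by
          rw [show p₀ + d - q = p₀ - q + d by omega, pow_add]; ring
  · intro p hp i hi
    obtain ⟨d, rfl⟩ := Nat.exists_eq_add_of_le hi
    rw [add_tsub_cancel_left]
    exact hup' p hp d

/-- The Potter bound dominates the sum by a geometric series; the induction on `q` closes because `κ
(2 - κ) = 1 - (1 - κ)^2 ≤ 1`. -/
theorem sum_dyadic_le {κ C : ℝ} {p₀ : ℕ} (hκ : 0 < κ) (hκ1 : κ < 1) (hC : 0 < C)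
    (hnn : ∀ n, 0 ≤ g n)
    (hdn : ∀ p ≥ p₀, ∀ q ≤ p, g (2 ^ q) ≤ C * κ ^ (p - q) * g (2 ^ p)) {p q : ℕ} (hp : p₀ ≤ p)
    (hq : q ≤ p) :
    ∑ i ∈ Finset.range q, g (2 ^ i) ≤ C / (1 - κ) * κ ^ (p - q) * g (2 ^ p) := by
  have h1 : ∀ q ≤ p, ∑ i ∈ Finset.range q, g (2 ^ i) ≤
      C / (1 - κ) * κ ^ (p - q) * g (2 ^ p) := by
    intro q
    induction q with
    | zero =>
      intro _
      have := hnn (2 ^ p)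
      have : 0 < 1 - κ := by linarith
      simp only [Finset.range_zero, Finset.sum_empty]
      positivity
    | succ q ih =>
      intro hq
      rw [Finset.sum_range_succ]
      have e : p - q = p - (q + 1) + 1 := by omega
      have h2 := ih (by omega)
      have h3 := hdn p hp q (by omega)
      have hk : 0 < 1 - κ := by linarith
      rw [e] at h2 h3
      calc _ ≤ C / (1 - κ) * κ ^ (p - (q + 1) + 1) * g (2 ^ p) +
            C * κ ^ (p - (q + 1) + 1) * g (2 ^ p) := add_le_add h2 h3
        _ = (C / (1 - κ) * (κ * (2 - κ))) * κ ^ (p - (q + 1)) * g (2 ^ p) := by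
          field_simp; ring
        _ ≤ (C / (1 - κ) * 1) * κ ^ (p - (q + 1)) * g (2 ^ p) := by
          have := hnn (2 ^ p)
          gcongr
          nlinarith [sq_nonneg (1 - κ)]
        _ = _ := by rw [mul_one]
  exact h1 q hq

/-- Potter bounds along dyadic scales, extended to all lengths below a dyadic one. -/
theorem exists_potter' (hg : IsRegVarNorm g a) (ha : 0 < a) (ha' : a < 1) :
    ∃ κ C : ℝ, ∃ p₀ : ℕ, 0 < κ ∧ κ < 1 ∧ 0 < C ∧ (∀ p ≥ p₀, 0 < g (2 ^ p)) ∧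
      (∀ p ≥ p₀, ∀ q ≤ p, ∀ m ≤ 2 ^ q, g m ≤ C * κ ^ (p - q) * g (2 ^ p)) ∧
      (∀ p ≥ p₀, ∀ i ≥ p, g (2 ^ i) ≤ (2 * κ) ^ (i - p) * g (2 ^ p)) := by
  obtain ⟨κ, C, p₀, hκ, hκ1, hC, hpos, hdn, hup⟩ := hg.exists_potter ha ha'
  have hk : 0 < 1 - κ := by linarith
  refine ⟨κ, C / (1 - κ), p₀, hκ, hκ1, by positivity, hpos, fun p hp q hq m hm => ?_, hup⟩
  have hgp := hpos p hp
  rcases hm.eq_or_lt with rfl | hm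
  · refine (hdn p hp q hq).trans ?_
    gcongr
    rw [le_div_iff₀ hk]
    nlinarith
  · exact (hg.le_sum_dyadic hm).trans (sum_dyadic_le hκ hκ1 hC hg.nonneg hdn hp hq)

/-- For each `l`, the multiples of `2 ^ q` in a dyadic block `[2 ^ (q + l), 2 ^ (q + l + 1))`
have norms at least about that of the left end. -/
theorem eventually_grid_ge (hg : IsRegVarNorm g a) (ha : 0 < a) (l : ℕ) :
    ∀ᶠ q : ℕ in atTop, ∀ j < 2 ^ (l + 1), 2 ^ l ≤ j →
      3 / 4 * g (2 ^ (q + l)) ≤ g (j * 2 ^ q) := by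
  have hpow : Tendsto (fun p : ℕ => 2 ^ p) atTop atTop := tendsto_pow_atTop_atTop_of_one_lt one_lt_two
  have : ∀ j ∈ Finset.range (2 ^ (l + 1)), ∀ᶠ q : ℕ in atTop, 2 ^ l ≤ j →
      3 / 4 * g (2 ^ (q + l)) ≤ g (j * 2 ^ q) := by
    intro j _
    by_cases hj : 2 ^ l ≤ j
    · have hj0 : 0 < j := lt_of_lt_of_le (by positivity) hj
      have hJ : (0 : ℝ) < ((2 ^ l : ℕ) : ℝ) ^ a := by positivity
      have h1 := (hg.tendsto_ratio j hj0).div (hg.tendsto_ratio (2 ^ l) (by positivity)) hJ.ne'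
      have h2 : (1 : ℝ) ≤ (j : ℝ) ^ a / ((2 ^ l : ℕ) : ℝ) ^ a := by
        rw [one_le_div hJ]
        exact Real.rpow_le_rpow (by positivity) (by exact_mod_cast hj) ha.le
      have h3 := h1.eventually_const_lt (show (3 / 4 : ℝ) < _ by linarith)
      have h4 := hpow.eventually (h3.and hg.eventually_pos)
      have h5 := (hpow.comp (tendsto_add_atTop_nat l)).eventually hg.eventually_pos
      filter_upwards [h4, h5] with q hq hq' _
      obtain ⟨hq1, hq2⟩ := hq
      simp only [Function.comp_apply] at hq'
      simp only [Pi.div_apply] at hq1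
      rw [div_div_div_cancel_right₀ hq2.ne', ← pow_add, add_comm l q, lt_div_iff₀ hq'] at hq1
      exact hq1.le
    · exact Eventually.of_forall fun q h => absurd h hj
  have := (Filter.eventually_all_finset _).2 this
  filter_upwards [this] with q hq j hj hj'
  exact hq j (Finset.mem_range.2 hj) hj'

/-- Within a dyadic block the norms are at least half of that of the left end. -/
theorem eventually_le_two_mul (hg : IsRegVarNorm g a) (ha : 0 < a) (ha' : a < 1) :
    ∀ᶠ p : ℕ in atTop, ∀ n, 2 ^ p ≤ n → n < 2 ^ (p + 1) → g (2 ^ p) ≤ 2 * g n := by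
  obtain ⟨κ, C, p₀, hκ, hκ1, hC, hpos, hdn, -⟩ := hg.exists_potter' ha ha'
  have : Tendsto (fun l : ℕ => C * κ ^ l) atTop (𝓝 (C * 0)) :=
    (tendsto_pow_atTop_nhds_zero_of_lt_one hκ.le hκ1).const_mul C
  rw [mul_zero] at this
  -- With this `l` the remainder beyond the last grid point costs at most `g (2 ^ p) / 4`, which
  -- leaves `3/4 - 1/4 = 1/2`.
  obtain ⟨l, hl⟩ := (this.eventually_lt_const (show (0 : ℝ) < 1 / 4 by norm_num)).exists
  have h1 := (tendsto_sub_atTop_nat l).eventually (hg.eventually_grid_ge ha l)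
  filter_upwards [h1, eventually_ge_atTop l, eventually_ge_atTop p₀] with p hp hpl hp0 n hn hn'
  have e : p - l + l = p := by omega
  rw [e] at hp
  have hj1 : 2 ^ l ≤ n / 2 ^ (p - l) := by
    rw [Nat.le_div_iff_mul_le (by positivity), ← pow_add, add_comm, e]
    exact hn
  have hj2 : n / 2 ^ (p - l) < 2 ^ (l + 1) := by
    rw [Nat.div_lt_iff_lt_mul (by positivity), ← pow_add, show l + 1 + (p - l) = p + 1 by omega]
    exact hn'
  have h2 := hp _ hj2 hj1
  have h3 := hdn p hp0 (p - l) (by omega) (n % 2 ^ (p - l)) (Nat.mod_lt _ (by positivity)).le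
  have h4 := hg.le_add (n / 2 ^ (p - l) * 2 ^ (p - l)) (n % 2 ^ (p - l))
  rw [Nat.div_add_mod'] at h4
  rw [show p - (p - l) = l by omega] at h3
  have h5 : C * κ ^ l * g (2 ^ p) ≤ 1 / 4 * g (2 ^ p) := by
    have := hg.nonneg (2 ^ p); gcongr
  linarith

end IsRegVarNorm

/-- The norms of the partial sums of a stationary sequence decorrelate geometrically along
dyadic scales. -/
theorem exists_abs_inner_dyadic_le {H : Type*} [NormedAddCommGroup H] [InnerProductSpace ℝ H]
    {z : ℕ → H} (hz : ∀ i j k, ⟪z (i + k), z (j + k)⟫ = ⟪z i, z j⟫) {a : ℝ}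
    (hg : IsRegVarNorm (fun n => ‖windowSum z 0 n‖) a) (ha : 0 < a) (ha' : a < 1) :
    ∃ κ C : ℝ, ∃ p₀ : ℕ, 0 < κ ∧ κ < 1 ∧ 0 < C ∧ (∀ p ≥ p₀, 0 < ‖windowSum z 0 (2 ^ p)‖) ∧
      ∀ p ≥ p₀, ∀ d, |⟪windowSum z 0 (2 ^ p), windowSum z 0 (2 ^ (p + 2 * d))⟫| ≤
        C * κ ^ d * (‖windowSum z 0 (2 ^ p)‖ * ‖windowSum z 0 (2 ^ (p + 2 * d))‖) := by
  obtain ⟨κ, C, p₀, hκ, hκ1, hC, hpos, hdn, hup⟩ := hg.exists_potter' ha ha'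
  refine ⟨κ, 2 * C + 1, p₀, hκ, hκ1, by positivity, hpos, fun p hp d => ?_⟩
  -- The number of shifts is the geometric mean of the two lengths: `g` gains `κ ^ d` from `s` up to
  -- `n`, and `m / s = 2 ^ (-d)` beats the growth `(2κ) ^ d` from `m` up to `s`.
  have h1 := abs_inner_windowSum_le hz (m := 2 ^ p) (n := 2 ^ (p + 2 * d)) (s := 2 ^ (p + d))
    (by positivity) (hdn (p + 2 * d) (by omega) (p + d) (by omega))
  have h2 := hup p hp (p + d) (by omega)
  rw [show p + 2 * d - (p + d) = d by omega] at h1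
  rw [show p + d - p = d by omega] at h2
  have h3 : ((2 ^ p : ℕ) : ℝ) / ((2 ^ (p + d) : ℕ) : ℝ) * ‖windowSum z 0 (2 ^ (p + d))‖ ≤
      κ ^ d * ‖windowSum z 0 (2 ^ p)‖ := by
    calc _ ≤ ((2 ^ p : ℕ) : ℝ) / ((2 ^ (p + d) : ℕ) : ℝ) * ((2 * κ) ^ d * ‖windowSum z 0 (2 ^ p)‖) := by
          gcongr
      _ = _ := by
        push_cast
        rw [mul_pow, pow_add]
        field_simp
  calc _ ≤ _ := h1
    _ ≤ 2 * (C * κ ^ d * ‖windowSum z 0 (2 ^ (p + 2 * d))‖) * ‖windowSum z 0 (2 ^ p)‖ +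
        κ ^ d * ‖windowSum z 0 (2 ^ p)‖ * ‖windowSum z 0 (2 ^ (p + 2 * d))‖ := by gcongr
    _ = _ := by ring

end

/-! ### Gaussian tails and the Gaussian embedding. -/

section

variable {Ω : Type*} [MeasurableSpace Ω] {P : Measure Ω}

section Gaussian

theorem map_eq_gaussianReal_of_integral_sq {f : Ω → ℝ} (hf : HasGaussianLaw f P)
    (h0 : ∫ ω, f ω ∂P = 0) {σ : ℝ} (hσ : ∫ ω, f ω * f ω ∂P = σ ^ 2) :
    P.map f = gaussianReal 0 (σ ^ 2).toNNReal := by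
  rw [hf.map_eq_gaussianReal, variance_of_integral_eq_zero hf.aemeasurable h0, h0, ← hσ]
  simp [sq]

/-- The Chernoff bound. The strict inequality in the event admits `σ = 0`, where `f` vanishes almost
surely. -/
theorem measure_lt_le_exp [IsProbabilityMeasure P] {f : Ω → ℝ} (hf : HasGaussianLaw f P)
    (h0 : ∫ ω, f ω ∂P = 0) {σ : ℝ} (hσ0 : 0 ≤ σ) (hσ : ∫ ω, f ω * f ω ∂P = σ ^ 2) {x : ℝ}
    (hx : 0 ≤ x) :
    P {ω | x * σ < f ω} ≤ ENNReal.ofReal (Real.exp (-x ^ 2 / 2)) := by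
  have hmap := map_eq_gaussianReal_of_integral_sq hf h0 hσ
  have hsub : HasSubgaussianMGF f (σ ^ 2).toNNReal P := by
    constructor
    · intro t
      have := integrable_exp_mul_gaussianReal (μ := 0) (v := (σ ^ 2).toNNReal) t
      rw [← hmap] at this
      exact this.comp_aemeasurable hf.aemeasurable
    · intro t
      rw [mgf_gaussianReal hmap]
      simp
  rcases hσ0.eq_or_lt with rfl | hpos
  · have : f =ᵐ[P] 0 := by
      refine HasSubgaussianMGF.ae_eq_zero_of_hasSubgaussianMGF_zero ?_
      simpa using hsub
    have h : P {ω | x * 0 < f ω} = 0 := by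
      rw [measure_eq_zero_iff_ae_notMem]
      filter_upwards [this] with ω hω
      simp [hω]
    rw [h]
    exact bot_le
  · have h := hsub.measure_ge_le (ε := x * σ) (by positivity)
    rw [Real.coe_toNNReal _ (sq_nonneg σ), show -(x * σ) ^ 2 / (2 * σ ^ 2) = -x ^ 2 / 2 by
      field_simp] at h
    calc P {ω | x * σ < f ω} ≤ P {ω | x * σ ≤ f ω} := 
        measure_mono fun ω h => by simp only [Set.mem_ofPred_eq] at h ⊢; exact h.le
      _ = ENNReal.ofReal (P.real {ω | x * σ ≤ f ω}) := by simp
      _ ≤ _ := ENNReal.ofReal_le_ofReal h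

theorem measure_lt_abs_le_exp [IsProbabilityMeasure P] {f : Ω → ℝ} (hf : HasGaussianLaw f P)
    (h0 : ∫ ω, f ω ∂P = 0) {σ : ℝ} (hσ0 : 0 ≤ σ) (hσ : ∫ ω, f ω * f ω ∂P = σ ^ 2) {x : ℝ}
    (hx : 0 ≤ x) :
    P {ω | x * σ < |f ω|} ≤ ENNReal.ofReal (2 * Real.exp (-x ^ 2 / 2)) := by
  have h1 := measure_lt_le_exp hf h0 hσ0 hσ hx
  have h2 := measure_lt_le_exp (f := fun ω => -f ω) hf.fun_neg (by rw [integral_neg, h0, neg_zero])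
    hσ0 (by simpa using hσ) hx
  rw [two_mul, ENNReal.ofReal_add (by positivity) (by positivity)]
  refine le_trans ?_ (add_le_add h1 h2)
  refine (measure_mono fun ω hω => ?_).trans (measure_union_le _ _)
  simpa [lt_abs] using hω

/-- On the interval from `x * σ` to `(x + 1) * σ`, of length `σ`, the density is at least its value
at the right end. The loss from `x` to `x + 1` is harmless on the logarithmic scale. -/
theorem exp_le_measure_le [IsProbabilityMeasure P] {f : Ω → ℝ} (hf : HasGaussianLaw f P)
    (h0 : ∫ ω, f ω ∂P = 0) {σ : ℝ} (hσ0 : 0 < σ) (hσ : ∫ ω, f ω * f ω ∂P = σ ^ 2) {x : ℝ}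
    (hx : 0 ≤ x) :
    ENNReal.ofReal ((Real.sqrt (2 * Real.pi))⁻¹ * Real.exp (-(x + 1) ^ 2 / 2)) ≤
      P {ω | x * σ ≤ f ω} := by
  have hmap := map_eq_gaussianReal_of_integral_sq hf h0 hσ
  have hv : (σ ^ 2).toNNReal ≠ 0 := by
    rw [Ne, Real.toNNReal_eq_zero, not_le]; positivity
  have h1 : P.map f (Set.Icc (x * σ) ((x + 1) * σ)) ≤ P {ω | x * σ ≤ f ω} := by
    rw [Measure.map_apply_of_aemeasurable hf.aemeasurable measurableSet_Icc]
    exact measure_mono fun ω hω => hω.1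
  refine le_trans ?_ h1
  rw [hmap, gaussianReal_apply _ hv]
  have h2 : ∀ y ∈ Set.Icc (x * σ) ((x + 1) * σ),
      ENNReal.ofReal ((Real.sqrt (2 * Real.pi))⁻¹ * σ⁻¹ * Real.exp (-(x + 1) ^ 2 / 2)) ≤
        gaussianPDF 0 (σ ^ 2).toNNReal y := by
    intro y hy
    refine ENNReal.ofReal_le_ofReal ?_
    rw [gaussianPDFReal, Real.coe_toNNReal _ (sq_nonneg σ), Real.sqrt_mul (x := 2 * Real.pi) (by positivity),
      Real.sqrt_sq hσ0.le, mul_inv, sub_zero]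
    gcongr ?_ * Real.exp ?_
    rw [neg_div, neg_div, neg_le_neg_iff, div_le_div_iff₀ (by positivity) (by positivity)]
    have hy0 : 0 ≤ y := le_trans (by positivity) hy.1
    have : y ^ 2 ≤ ((x + 1) * σ) ^ 2 := by gcongr; exact hy.2
    nlinarith
  calc _ = ENNReal.ofReal ((Real.sqrt (2 * Real.pi))⁻¹ * σ⁻¹ * Real.exp (-(x + 1) ^ 2 / 2)) *
        volume (Set.Icc (x * σ) ((x + 1) * σ)) := by
        rw [Real.volume_Icc, ← ENNReal.ofReal_mul (by positivity)]
        congr 1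
        field_simp
        ring
    _ = ∫⁻ _ in Set.Icc (x * σ) ((x + 1) * σ),
        ENNReal.ofReal ((Real.sqrt (2 * Real.pi))⁻¹ * σ⁻¹ * Real.exp (-(x + 1) ^ 2 / 2)) := by
        rw [setLIntegral_const]
    _ ≤ _ := setLIntegral_mono' measurableSet_Icc h2

theorem ae_eventually_notMem_of_summable {s : ℕ → Set Ω} {u : ℕ → ℝ} (hu : Summable u)
    (h : ∀ᶠ n in atTop, P (s n) ≤ ENNReal.ofReal (u n)) :
    ∀ᵐ ω ∂P, ∀ᶠ n in atTop, ω ∉ s n := by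
  obtain ⟨N, hN⟩ := eventually_atTop.1 h
  have hsum : Summable fun n => u (n + N) := (summable_nat_add_iff N).2 hu
  have : ∑' n, P (s (n + N)) ≠ ∞ :=
    ne_top_of_le_ne_top hsum.tsum_ofReal_ne_top
      (ENNReal.tsum_le_tsum fun n => hN (n + N) (by omega))
  filter_upwards [ae_eventually_notMem this] with ω hω
  exact (eventually_map (m := fun n => n + N) (P := fun n => ω ∉ s n)).2 hω |>.filter_mono
    (by rw [map_add_atTop_eq_nat])

end Gaussian

section Embedding

variable {H : Type*} [NormedAddCommGroup H] [InnerProductSpace ℝ H]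

/-- The finite linear combinations of `Z` form a centered Gaussian family whose covariances are
the inner products of the corresponding combinations of `z`. -/
structure IsGaussianEmbedding (P : Measure Ω) (Z : ℕ → Ω → ℝ) (z : ℕ → H) : Prop where
  gaussian : IsGaussianProcess (fun c : ℕ →₀ ℝ => Finsupp.linearCombination ℝ Z c) P
  centered : ∀ c : ℕ →₀ ℝ, ∫ ω, Finsupp.linearCombination ℝ Z c ω ∂P = 0
  inner_eq : ∀ c d : ℕ →₀ ℝ, ∫ ω, Finsupp.linearCombination ℝ Z c ω *
    Finsupp.linearCombination ℝ Z d ω ∂P =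
      ⟪Finsupp.linearCombination ℝ z c, Finsupp.linearCombination ℝ z d⟫

variable {Z : ℕ → Ω → ℝ} {z : ℕ → H}

/-- The coefficients of a sum of consecutive terms. -/
noncomputable def windowCoeff (b n : ℕ) : ℕ →₀ ℝ := windowSum (fun i => Finsupp.single i 1) b n

theorem linearCombination_windowCoeff {M : Type*} [AddCommGroup M] [Module ℝ M] (z : ℕ → M)
    (b n : ℕ) : Finsupp.linearCombination ℝ z (windowCoeff b n) = windowSum z b n := by
  simp [windowCoeff, windowSum, map_sum]

namespace IsGaussianEmbedding

theorem integral_sq (hZ : IsGaussianEmbedding P Z z) (c : ℕ →₀ ℝ) :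
    ∫ ω, Finsupp.linearCombination ℝ Z c ω * Finsupp.linearCombination ℝ Z c ω ∂P =
      ‖Finsupp.linearCombination ℝ z c‖ ^ 2 := by
  rw [hZ.inner_eq, real_inner_self_eq_norm_sq]

theorem measure_lt_le [IsProbabilityMeasure P] (hZ : IsGaussianEmbedding P Z z) (c : ℕ →₀ ℝ)
    {x : ℝ} (hx : 0 ≤ x) :
    P {ω | x * ‖Finsupp.linearCombination ℝ z c‖ < Finsupp.linearCombination ℝ Z c ω} ≤
      ENNReal.ofReal (Real.exp (-x ^ 2 / 2)) :=
  measure_lt_le_exp (hZ.gaussian.hasGaussianLaw_eval c) (hZ.centered c) (norm_nonneg _)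
    (hZ.integral_sq c) hx

theorem measure_lt_abs_le [IsProbabilityMeasure P] (hZ : IsGaussianEmbedding P Z z) (c : ℕ →₀ ℝ)
    {x : ℝ} (hx : 0 ≤ x) :
    P {ω | x * ‖Finsupp.linearCombination ℝ z c‖ < |Finsupp.linearCombination ℝ Z c ω|} ≤
      ENNReal.ofReal (2 * Real.exp (-x ^ 2 / 2)) :=
  measure_lt_abs_le_exp (hZ.gaussian.hasGaussianLaw_eval c) (hZ.centered c) (norm_nonneg _)
    (hZ.integral_sq c) hx

theorem le_measure_le [IsProbabilityMeasure P] (hZ : IsGaussianEmbedding P Z z) (c : ℕ →₀ ℝ)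
    (hc : 0 < ‖Finsupp.linearCombination ℝ z c‖) {x : ℝ} (hx : 0 ≤ x) :
    ENNReal.ofReal ((Real.sqrt (2 * Real.pi))⁻¹ * Real.exp (-(x + 1) ^ 2 / 2)) ≤
      P {ω | x * ‖Finsupp.linearCombination ℝ z c‖ ≤ Finsupp.linearCombination ℝ Z c ω} :=
  exp_le_measure_le (hZ.gaussian.hasGaussianLaw_eval c) (hZ.centered c) hc (hZ.integral_sq c) hx

end IsGaussianEmbedding

end Embedding

end

section

variable {Ω : Type*} [MeasurableSpace Ω] {P : Measure Ω}

/-! ### The upper half of the law. -/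

section Upper

variable {H : Type*} [NormedAddCommGroup H] [InnerProductSpace ℝ H]
variable {Z : ℕ → Ω → ℝ} {z : ℕ → H}

theorem windowSum_apply {Ω : Type*} (Z : ℕ → Ω → ℝ) (b n : ℕ) (ω : Ω) :
    windowSum Z b n ω = windowSum (fun i => Z i ω) b n := by
  simp [windowSum, Finset.sum_apply]

namespace IsGaussianEmbedding

/-- Almost surely, in all but finitely many dyadic blocks, all dyadic windows in the block
are of the order of the square root of the logarithm of the block number. -/
theorem ae_eventually_dyadic [IsProbabilityMeasure P] (hZ : IsGaussianEmbedding P Z z)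
    (hz : ∀ i j k, ⟪z (i + k), z (j + k)⟫ = ⟪z i, z j⟫) :
    ∀ᵐ ω ∂P, ∀ᶠ p : ℕ in atTop, ∀ e ≤ p, ∀ t < 2 ^ (e + 1),
      |windowSum (fun i => Z i ω) (t * 2 ^ (p - e)) (2 ^ (p - e))| ≤
        2 * (e + 1) * √(Real.log p) * ‖windowSum z 0 (2 ^ (p - e))‖ := by
  -- At depth `e` there are `2 ^ (e + 1)` windows, each exceeding its level with probability at most
  -- `2 p ^ (-2 (e + 1))`. The level grows linearly in `e` so that the tail beats this count; the
  -- total is at most `8 / p ^ 2`.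
  let s : ℕ → Set Ω := fun p => ⋃ e ∈ Finset.range (p + 1), ⋃ t ∈ Finset.range (2 ^ (e + 1)),
    {ω | 2 * (e + 1) * √(Real.log p) * ‖windowSum z (t * 2 ^ (p - e)) (2 ^ (p - e))‖ <
      |windowSum Z (t * 2 ^ (p - e)) (2 ^ (p - e)) ω|}
  have hs : Summable fun p : ℕ => 8 * (1 / (p : ℝ) ^ 2) :=
    (Real.summable_one_div_nat_pow.2 one_lt_two).mul_left 8
  have hP : ∀ᶠ p in atTop, P (s p) ≤ ENNReal.ofReal (8 * (1 / (p : ℝ) ^ 2)) := by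
    filter_upwards [eventually_ge_atTop 2] with p hp
    have hp' : (2 : ℝ) ≤ p := by exact_mod_cast hp
    have hp0 : (0 : ℝ) < p := by linarith
    have hlog : 0 ≤ Real.log p := Real.log_nonneg (by linarith)
    have hone : ∀ e t : ℕ, P {ω | 2 * (e + 1) * √(Real.log p) *
        ‖windowSum z (t * 2 ^ (p - e)) (2 ^ (p - e))‖ <
          |windowSum Z (t * 2 ^ (p - e)) (2 ^ (p - e)) ω|} ≤
        ENNReal.ofReal (2 * (1 / (p : ℝ) ^ 2) ^ (e + 1)) := by
      intro e t
      have h := hZ.measure_lt_abs_le (windowCoeff (t * 2 ^ (p - e)) (2 ^ (p - e)))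
        (x := 2 * (e + 1) * √(Real.log p)) (by positivity)
      simp only [linearCombination_windowCoeff] at h
      refine h.trans (ENNReal.ofReal_le_ofReal ?_)
      have hexp : (1 / (p : ℝ) ^ 2) ^ (e + 1) = Real.exp (-2 * (e + 1) * Real.log p) := by
        rw [show -2 * ((e : ℝ) + 1) * Real.log p = ((e + 1 : ℕ) : ℝ) * (-(2 * Real.log p)) by
          push_cast; ring, Real.exp_nat_mul, Real.exp_neg, mul_comm 2, Real.exp_mul,
          Real.exp_log hp0]
        norm_num
      rw [hexp]
      gcongr
      rw [mul_pow, Real.sq_sqrt hlog]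
      have : (0 : ℝ) ≤ e := e.cast_nonneg
      nlinarith [mul_nonneg (mul_nonneg this (by linarith : (0:ℝ) ≤ e + 1)) hlog]
    have htwo : ∀ e : ℕ, P (⋃ t ∈ Finset.range (2 ^ (e + 1)),
        {ω | 2 * (e + 1) * √(Real.log p) * ‖windowSum z (t * 2 ^ (p - e)) (2 ^ (p - e))‖ <
          |windowSum Z (t * 2 ^ (p - e)) (2 ^ (p - e)) ω|}) ≤
        ENNReal.ofReal (4 * (1 / (p : ℝ) ^ 2) * (1 / 2) ^ e) := by
      intro e
      refine (measure_biUnion_finset_le _ _).trans ?_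
      refine (Finset.sum_le_sum fun t _ => hone e t).trans ?_
      rw [Finset.sum_const, Finset.card_range, nsmul_eq_mul, ← ENNReal.ofReal_natCast,
        ← ENNReal.ofReal_mul (by positivity)]
      refine ENNReal.ofReal_le_ofReal ?_
      have h4 : 2 * (1 / (p : ℝ) ^ 2) ≤ 1 / 2 := by
        rw [mul_one_div, div_le_div_iff₀ (by positivity) (by positivity)]
        nlinarith
      calc ((2 ^ (e + 1) : ℕ) : ℝ) * (2 * (1 / (p : ℝ) ^ 2) ^ (e + 1)) =
          4 * (1 / (p : ℝ) ^ 2) * (2 * (1 / (p : ℝ) ^ 2)) ^ e := by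
            push_cast
            rw [mul_pow, pow_succ, pow_succ]
            ring
        _ ≤ _ := by gcongr
    refine (measure_biUnion_finset_le _ _).trans ((Finset.sum_le_sum fun e _ => htwo e).trans ?_)
    rw [← ENNReal.ofReal_sum_of_nonneg (fun e _ => by positivity), ← Finset.mul_sum]
    refine ENNReal.ofReal_le_ofReal ?_
    have hgeo : ∑ i ∈ Finset.range (p + 1), (1 / 2 : ℝ) ^ i ≤ 2 := by
      refine (Summable.sum_le_tsum _ (fun _ _ => by positivity) summable_geometric_two).trans ?_
      exact tsum_geometric_two.le
    have : 0 ≤ 4 * (1 / (p : ℝ) ^ 2) := by positivity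
    nlinarith
  filter_upwards [ae_eventually_notMem_of_summable hs hP] with ω hω
  filter_upwards [hω] with p hp e he t ht
  by_contra hlt
  rw [not_le] at hlt
  refine hp (Set.mem_biUnion (x := e) (by simpa using Nat.lt_succ_of_le he)
    (Set.mem_biUnion (x := t) (by simpa using ht) ?_))
  simp only [Set.mem_ofPred_eq]
  rwa [norm_windowSum hz, windowSum_apply]

/-- Almost surely, in all but finitely many dyadic blocks, the upper bound of the law of the
iterated logarithm holds on a grid of `2 ^ l` points. -/
theorem ae_eventually_grid [IsProbabilityMeasure P] (hZ : IsGaussianEmbedding P Z z) (l : ℕ)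
    {ε : ℝ} (hε : 0 < ε) :
    ∀ᵐ ω ∂P, ∀ᶠ p : ℕ in atTop, ∀ j < 2 ^ (l + 1),
      windowSum (fun i => Z i ω) 0 (j * 2 ^ (p - l)) ≤
        (1 + ε) * √(2 * Real.log p) * ‖windowSum z 0 (j * 2 ^ (p - l))‖ := by
  let s : ℕ → Set Ω := fun p => ⋃ j ∈ Finset.range (2 ^ (l + 1)),
    {ω | (1 + ε) * √(2 * Real.log p) * ‖windowSum z 0 (j * 2 ^ (p - l))‖ <
      windowSum Z 0 (j * 2 ^ (p - l)) ω}
  -- The number of grid points is independent of `p`, so an exponent `(1 + ε) ^ 2 > 1` is enough.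
  have hs : Summable fun p : ℕ => ((2 ^ (l + 1) : ℕ) : ℝ) * (p : ℝ) ^ (-(1 + ε) ^ 2) :=
    (Real.summable_nat_rpow.2 (by nlinarith)).mul_left _
  have hP : ∀ᶠ p in atTop, P (s p) ≤
      ENNReal.ofReal (((2 ^ (l + 1) : ℕ) : ℝ) * (p : ℝ) ^ (-(1 + ε) ^ 2)) := by
    filter_upwards [eventually_ge_atTop 1] with p hp
    have hp' : (1 : ℝ) ≤ p := by exact_mod_cast hp
    have hlog : 0 ≤ Real.log p := Real.log_nonneg hp'
    have hone : ∀ j : ℕ, P {ω | (1 + ε) * √(2 * Real.log p) *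
        ‖windowSum z 0 (j * 2 ^ (p - l))‖ < windowSum Z 0 (j * 2 ^ (p - l)) ω} ≤
        ENNReal.ofReal ((p : ℝ) ^ (-(1 + ε) ^ 2)) := by
      intro j
      have h := hZ.measure_lt_le (windowCoeff 0 (j * 2 ^ (p - l)))
        (x := (1 + ε) * √(2 * Real.log p)) (by positivity)
      simp only [linearCombination_windowCoeff] at h
      refine h.trans (ENNReal.ofReal_le_ofReal ?_)
      rw [Real.rpow_def_of_pos (by linarith), mul_pow, Real.sq_sqrt (by positivity)]
      exact Real.exp_le_exp.2 (by linarith)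
    refine (measure_biUnion_finset_le _ _).trans ((Finset.sum_le_sum fun j _ => hone j).trans ?_)
    rw [Finset.sum_const, Finset.card_range, nsmul_eq_mul, ← ENNReal.ofReal_natCast,
        ← ENNReal.ofReal_mul (by positivity)]
  filter_upwards [ae_eventually_notMem_of_summable hs hP] with ω hω
  filter_upwards [hω] with p hp j hj
  by_contra hlt
  rw [not_le] at hlt
  refine hp (Set.mem_biUnion (x := j) (by simpa using hj) ?_)
  simp only [Set.mem_ofPred_eq]
  rwa [windowSum_apply]

end IsGaussianEmbedding

/-- For `n ≥ 2 ^ p`, `log log n ≥ log p + log log 2`, and the factor `c > 1` absorbs the negative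
constant. -/
theorem eventually_log_le_mul_log_log {c : ℝ} (hc : 1 < c) :
    ∀ᶠ p : ℕ in atTop, ∀ n : ℕ, 2 ^ p ≤ n → Real.log p ≤ c * Real.log (Real.log n) := by
  have hlog : Tendsto (fun p : ℕ => Real.log p) atTop atTop :=
    Real.tendsto_log_atTop.comp tendsto_natCast_atTop_atTop
  filter_upwards [hlog.eventually_ge_atTop (-(c * Real.log (Real.log 2)) / (c - 1)),
    eventually_ge_atTop 1] with p hp hp1 n hn
  rw [div_le_iff₀ (by linarith)] at hp
  have hp0 : (0 : ℝ) < p := by exact_mod_cast hp1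
  have hl2 := Real.log_pos one_lt_two
  have h1 : p * Real.log 2 ≤ Real.log n := by
    rw [← Real.log_pow]
    exact Real.log_le_log (by positivity) (by exact_mod_cast hn)
  have h2 : Real.log p + Real.log (Real.log 2) ≤ Real.log (Real.log n) := by
    rw [← Real.log_mul hp0.ne' hl2.ne']
    exact Real.log_le_log (by positivity) h1
  nlinarith

/-- Interpolation between the grid points of the dyadic blocks. -/
theorem IsRegVarNorm.eventually_windowSum_le {g : ℕ → ℝ} {a : ℝ} (hg : IsRegVarNorm g a)
    (ha : 0 < a) (ha' : a < 1) {x : ℕ → ℝ} {ε : ℝ} (hε : 0 < ε)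
    (hD : ∀ᶠ p : ℕ in atTop, ∀ e ≤ p, ∀ t < 2 ^ (e + 1),
      |windowSum x (t * 2 ^ (p - e)) (2 ^ (p - e))| ≤
        2 * (e + 1) * √(Real.log p) * g (2 ^ (p - e)))
    (hG : ∀ l : ℕ, ∀ᶠ p : ℕ in atTop, ∀ j < 2 ^ (l + 1),
      windowSum x 0 (j * 2 ^ (p - l)) ≤ (1 + ε) * √(2 * Real.log p) * g (j * 2 ^ (p - l))) :
    ∀ᶠ n : ℕ in atTop,
      windowSum x 0 n ≤ (1 + ε) ^ 3 * (√(2 * Real.log (Real.log n)) * g n) := by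
  obtain ⟨κ, C, p₀, hκ, hκ1, hC, hpos, hdn, -⟩ := hg.exists_potter' ha ha'
  -- The level `e + 1` of the dyadic windows at depth `e` times the Potter decay of their norms.
  let f : ℕ → ℝ := fun e => (e + 1) * κ ^ e
  have hfnn : ∀ e, 0 ≤ f e := fun e => by positivity
  have hf : Summable f := by
    have h1 := summable_pow_mul_geometric_of_norm_lt_one 1 (r := κ)
      (by rwa [Real.norm_of_nonneg hκ.le])
    have h2 := summable_geometric_of_lt_one hκ.le hκ1
    refine (h1.add h2).congr fun e => ?_
    simp only [f]; ring
  have hT : Tendsto (fun l : ℕ => ∑' i, f (i + (l + 1))) atTop (𝓝 0) :=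
    (tendsto_sum_nat_add f).comp (tendsto_add_atTop_nat 1)
  have hT' : Tendsto (fun l : ℕ => 4 * C * ∑' i, f (i + (l + 1))) atTop (𝓝 0) := by
    simpa using hT.const_mul (4 * C)
  have hK : Tendsto (fun l : ℕ => 2 * C * κ ^ l) atTop (𝓝 0) := by
    simpa using (tendsto_pow_atTop_nhds_zero_of_lt_one hκ.le hκ1).const_mul (2 * C)
  -- The grid is fine enough for two errors: the chain of dyadic windows of depth above `l`, and the
  -- change of `g` between `n` and the grid point below it.
  obtain ⟨l, hl1, hl2⟩ := ((hT'.eventually_lt_const (half_pos hε)).and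
    (hK.eventually_lt_const (half_pos hε))).exists
  have hblock : ∀ᶠ p : ℕ in atTop, ∀ n, 2 ^ p ≤ n → n < 2 ^ (p + 1) →
      windowSum x 0 n ≤ (1 + ε) ^ 2 * (√(2 * Real.log p) * g n) := by
    filter_upwards [hD, hG l, hg.eventually_le_two_mul ha ha', eventually_ge_atTop l,
      eventually_ge_atTop p₀] with p hDp hGp htwo hpl hp0 n hn hn'
    have hgn := htwo n hn hn'
    set q := p - l with hq
    have e : q + l = p := by omega
    have hj1 : 2 ^ l ≤ n / 2 ^ q := by
      rw [Nat.le_div_iff_mul_le (by positivity), ← pow_add, add_comm, e]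
      exact hn
    have hj2 : n / 2 ^ q < 2 ^ (l + 1) := by
      rw [Nat.div_lt_iff_lt_mul (by positivity), ← pow_add, show l + 1 + q = p + 1 by omega]
      exact hn'
    have hm : n % 2 ^ q < 2 ^ q := Nat.mod_lt _ (by positivity)
    set b := n / 2 ^ q * 2 ^ q with hb
    have hbm : b + n % 2 ^ q = n := Nat.div_add_mod' _ _
    have hgrid := hGp _ hj2
    have hgm : g (n % 2 ^ q) ≤ ε / 2 * g n := by
      have h1 := hdn p hp0 q (by omega) _ hm.le
      rw [show p - q = l by omega] at h1
      have h2 : C * κ ^ l * g (2 ^ p) ≤ C * κ ^ l * (2 * g n) := by gcongr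
      nlinarith [hg.nonneg n]
    have hgb : g b ≤ (1 + ε / 2) * g n := by
      have := hg.le_add b (n % 2 ^ q)
      rw [hbm] at this
      linarith
    have hlogp : √(Real.log p) ≤ √(2 * Real.log p) :=
      Real.sqrt_le_sqrt (by
        have : 0 ≤ Real.log p := Real.log_natCast_nonneg p
        linarith)
    have hwin : windowSum x b (n % 2 ^ q) ≤ ε / 2 * (√(2 * Real.log p) * g n) := by
      let B : ℕ → ℝ := fun i => 2 * ((p - i : ℕ) + 1) * √(Real.log p) * g (2 ^ i)
      have hB : ∀ i, 0 ≤ B i := fun i =>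
        mul_nonneg (by positivity) (hg.nonneg _)
      have h1 := abs_windowSum_le_sum_dyadic (x := x) (lo := 0) (hi := 2 ^ (p + 1)) (q := q) hB
        (fun i hi t _ ht => by
          have h := hDp (p - i) (by omega) t (by
            rw [← Nat.mul_lt_mul_right (a := 2 ^ i) (by positivity), ← pow_add,
              show p - i + 1 + i = p + 1 by omega]
            exact ht)
          rwa [show p - (p - i) = i by omega] at h)
        (b := b) (m := n % 2 ^ q) (Dvd.intro_left _ rfl) (Nat.zero_le _) (by omega) hm
      have h2 : ∑ i ∈ Finset.range q, B i ≤
          2 * √(Real.log p) * (C * g (2 ^ p)) * ∑ i ∈ Finset.range q, f (p - i) := by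
        rw [Finset.mul_sum]
        refine Finset.sum_le_sum fun i hi => ?_
        have hi := Finset.mem_range.1 hi
        have h3 := hdn p hp0 i (by omega) _ le_rfl
        calc B i ≤ 2 * ((p - i : ℕ) + 1) * √(Real.log p) * (C * κ ^ (p - i) * g (2 ^ p)) := by
              simp only [B]; gcongr
          _ = _ := by simp only [f]; ring
      have h4 : ∑ i ∈ Finset.range q, f (p - i) ≤ ∑' i, f (i + (l + 1)) := by
        rw [← Finset.sum_range_reflect]
        have : ∀ i ∈ Finset.range q, f (p - (q - 1 - i)) = f (i + (l + 1)) := by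
          intro i hi
          have hi := Finset.mem_range.1 hi
          congr 1
          omega
        rw [Finset.sum_congr rfl this]
        exact Summable.sum_le_tsum _ (fun _ _ => hfnn _) ((summable_nat_add_iff (l + 1)).2 hf)
      have h5 : 0 ≤ ∑' i, f (i + (l + 1)) := tsum_nonneg fun i => hfnn _
      calc windowSum x b (n % 2 ^ q) ≤ _ := (le_abs_self _).trans (h1.trans h2)
        _ ≤ 2 * √(2 * Real.log p) * (C * (2 * g n)) * ∑' i, f (i + (l + 1)) := by
          have := hg.nonneg n
          have := hg.nonneg (2 ^ p)
          gcongr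
        _ = (4 * C * ∑' i, f (i + (l + 1))) * (√(2 * Real.log p) * g n) := by ring
        _ ≤ _ := by
          have := hg.nonneg n
          gcongr
    have hsplit : windowSum x 0 n = windowSum x 0 b + windowSum x b (n % 2 ^ q) := by
      conv_lhs => rw [← hbm]
      rw [windowSum_add, zero_add]
    have hS : 0 ≤ √(2 * Real.log p) * g n := mul_nonneg (Real.sqrt_nonneg _) (hg.nonneg n)
    have h6 : (1 + ε) * √(2 * Real.log p) * g b ≤
        (1 + ε) * √(2 * Real.log p) * ((1 + ε / 2) * g n) := by gcongr
    rw [hsplit]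
    -- The factors combine through `(1 + ε) (1 + ε / 2) + ε / 2 ≤ (1 + ε) ^ 2`.
    nlinarith [mul_nonneg (mul_nonneg hε.le hε.le) hS]
  have hc : 1 < (1 + ε) ^ 2 := by nlinarith
  have hlog : Tendsto (Nat.log 2) atTop atTop := by
    refine tendsto_atTop.2 fun m => ?_
    filter_upwards [eventually_ge_atTop (2 ^ m)] with n hn
    exact Nat.le_log_of_pow_le one_lt_two hn
  filter_upwards [hlog.eventually hblock, hlog.eventually (eventually_log_le_mul_log_log hc),
    eventually_ge_atTop 1] with n h1 h2 hn
  have hn1 : 2 ^ Nat.log 2 n ≤ n := Nat.pow_log_le_self 2 (by omega)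
  have hn2 : n < 2 ^ (Nat.log 2 n + 1) := Nat.lt_pow_succ_log_self one_lt_two n
  have h3 : √(2 * Real.log (Nat.log 2 n)) ≤ (1 + ε) * √(2 * Real.log (Real.log n)) := by
    calc √(2 * Real.log (Nat.log 2 n)) ≤ √((1 + ε) ^ 2 * (2 * Real.log (Real.log n))) :=
          Real.sqrt_le_sqrt (by linarith [h2 n hn1])
      _ = _ := by rw [Real.sqrt_mul (by positivity), Real.sqrt_sq (by positivity)]
  calc windowSum x 0 n ≤ (1 + ε) ^ 2 * (√(2 * Real.log (Nat.log 2 n)) * g n) := h1 n hn1 hn2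
    _ ≤ (1 + ε) ^ 2 * ((1 + ε) * √(2 * Real.log (Real.log n)) * g n) := by
      have := hg.nonneg n
      gcongr
    _ = _ := by ring

end Upper

end

section

variable {H : Type*} [NormedAddCommGroup H] [InnerProductSpace ℝ H]

/-! ### Almost orthonormal vectors. -/

section AlmostOrthogonal

variable {v : ℕ → H} {ρ : ℕ → ℝ} {θ : ℝ}

theorem sum_abs_inner_lower_le (hρ : ∀ i d, |⟪v i, v (i + d + 1)⟫| ≤ ρ d) (hs : Summable ρ)
    (hθ : ∑' d, ρ d ≤ θ / 2) (i : ℕ) :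
    ∑ j ∈ Finset.range i, |⟪v i, v j⟫| ≤ θ / 2 := by
  have hρ0 : ∀ d, 0 ≤ ρ d := fun d => (abs_nonneg _).trans (hρ 0 d)
  refine le_trans ?_ ((hs.sum_le_tsum (Finset.range i) fun d _ => hρ0 d).trans hθ)
  rw [← Finset.sum_range_reflect]
  refine Finset.sum_le_sum fun d hd => ?_
  have hd := Finset.mem_range.1 hd
  have := hρ (i - 1 - d) d
  rwa [show i - 1 - d + d + 1 = i by omega, real_inner_comm] at this

theorem sum_abs_inner_offDiag_le (hρ : ∀ i d, |⟪v i, v (i + d + 1)⟫| ≤ ρ d) (hs : Summable ρ)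
    (hθ : ∑' d, ρ d ≤ θ / 2) {i k : ℕ} (hi : i < k) :
    ∑ j ∈ Finset.range k, (if i = j then 0 else |⟪v i, v j⟫|) ≤ θ := by
  have hρ0 : ∀ d, 0 ≤ ρ d := fun d => (abs_nonneg _).trans (hρ 0 d)
  obtain ⟨r, rfl⟩ := Nat.exists_eq_add_of_le (Nat.succ_le_of_lt hi)
  rw [Finset.sum_range_add, Nat.succ_eq_add_one, Finset.sum_range_succ]
  have h1 : ∑ j ∈ Finset.range i, (if i = j then 0 else |⟪v i, v j⟫|) ≤ θ / 2 := by
    refine le_trans (le_of_eq ?_) (sum_abs_inner_lower_le hρ hs hθ i)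
    exact Finset.sum_congr rfl fun j hj => if_neg (Finset.mem_range.1 hj).ne'
  have h2 : ∑ d ∈ Finset.range r, (if i = i + 1 + d then 0 else |⟪v i, v (i + 1 + d)⟫|) ≤
      θ / 2 := by
    refine le_trans (Finset.sum_le_sum fun d _ => ?_)
      ((hs.sum_le_tsum (Finset.range r) fun d _ => hρ0 d).trans hθ)
    rw [if_neg (by omega), add_right_comm]
    exact hρ i d
  rw [if_pos rfl]
  linarith

/-- A lower Riesz bound for almost orthonormal vectors. -/
theorem sum_sq_le_norm_sq (hv : ∀ i, ‖v i‖ = 1)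
    (hρ : ∀ i d, |⟪v i, v (i + d + 1)⟫| ≤ ρ d) (hs : Summable ρ)
    (hθ : ∑' d, ρ d ≤ θ / 2) (c : ℕ → ℝ) (k : ℕ) :
    (1 - θ) * ∑ i ∈ Finset.range k, c i ^ 2 ≤ ‖∑ i ∈ Finset.range k, c i • v i‖ ^ 2 := by
  -- Schur's test: the off-diagonal Gram matrix has absolute row sums at most `θ`, and `|c i * c j|`
  -- is at most the mean of the two squares.
  let A : ℕ → ℕ → ℝ := fun i j => if i = j then 0 else |⟪v i, v j⟫|
  have hsymm : ∀ i j, A i j = A j i := fun i j => by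
    simp only [A, eq_comm (a := i), real_inner_comm]
  have hA : ∀ i ∈ Finset.range k, c i ^ 2 * ∑ j ∈ Finset.range k, A i j ≤ c i ^ 2 * θ :=
    fun i hi => mul_le_mul_of_nonneg_left
      (sum_abs_inner_offDiag_le hρ hs hθ (Finset.mem_range.1 hi)) (sq_nonneg _)
  have h1 : ∑ i ∈ Finset.range k, ∑ j ∈ Finset.range k, c i ^ 2 * A i j ≤
      (∑ i ∈ Finset.range k, c i ^ 2) * θ := by
    rw [Finset.sum_mul]
    exact Finset.sum_le_sum fun i hi => by rw [← Finset.mul_sum]; exact hA i hi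
  have h2 : ∑ i ∈ Finset.range k, ∑ j ∈ Finset.range k, c j ^ 2 * A i j ≤
      (∑ i ∈ Finset.range k, c i ^ 2) * θ := by
    rw [Finset.sum_comm]
    simpa only [hsymm] using h1
  have h3 : ∀ i j, (if i = j then c i ^ 2 else 0) - (c i ^ 2 * A i j + c j ^ 2 * A i j) / 2 ≤
      c i * (c j * ⟪v i, v j⟫) := by
    intro i j
    by_cases h : i = j
    · subst h
      simp [A, hv, sq]
    · simp only [A, if_neg h]
      have hab : |c i * c j| ≤ (c i ^ 2 + c j ^ 2) / 2 := by
        rw [abs_mul, ← sq_abs (c i), ← sq_abs (c j)]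
        nlinarith [sq_nonneg (|c i| - |c j|)]
      have := neg_abs_le (c i * c j * ⟪v i, v j⟫)
      rw [abs_mul] at this
      have := mul_le_mul_of_nonneg_right hab (abs_nonneg ⟪v i, v j⟫)
      linarith
  have h4 : ‖∑ i ∈ Finset.range k, c i • v i‖ ^ 2 =
      ∑ i ∈ Finset.range k, ∑ j ∈ Finset.range k, c i * (c j * ⟪v i, v j⟫) := by
    rw [← real_inner_self_eq_norm_sq, sum_inner]
    simp_rw [inner_sum, real_inner_smul_left, real_inner_smul_right]
  have h5 := Finset.sum_le_sum fun i (_ : i ∈ Finset.range k) =>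
    Finset.sum_le_sum fun j (_ : j ∈ Finset.range k) => h3 i j
  have h6 : ∑ i ∈ Finset.range k, ∑ j ∈ Finset.range k, (if i = j then c i ^ 2 else 0) =
      ∑ i ∈ Finset.range k, c i ^ 2 := by
    refine Finset.sum_congr rfl fun i hi => ?_
    rw [Finset.sum_ite_eq, if_pos hi]
  rw [h4]
  simp only [Finset.sum_sub_distrib, ← Finset.sum_div, Finset.sum_add_distrib, h6] at h5
  linarith

/-- The projection of a vector of an almost orthonormal sequence on the span of the previous ones
is small. -/
theorem exists_coeff_orthogonal (hv : ∀ i, ‖v i‖ = 1)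
    (hρ : ∀ i d, |⟪v i, v (i + d + 1)⟫| ≤ ρ d) (hs : Summable ρ)
    (hθ : ∑' d, ρ d ≤ θ / 2) (hθ' : θ ≤ 1 / 2) (k : ℕ) :
    ∃ c : ℕ → ℝ, (∀ j < k, ⟪v k - ∑ i ∈ Finset.range k, c i • v i, v j⟫ = 0) ∧
      ‖∑ i ∈ Finset.range k, c i • v i‖ ^ 2 ≤ θ := by
  let K : Submodule ℝ H := Submodule.span ℝ (Set.range fun j : Fin k => v j)
  have : FiniteDimensional ℝ K := FiniteDimensional.span_of_finite ℝ (Set.finite_range _)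
  have hmem := K.starProjection_apply_mem (v k)
  obtain ⟨c', hc'⟩ := (Submodule.mem_span_range_iff_exists_fun ℝ).1 hmem
  let c : ℕ → ℝ := fun i => if h : i < k then c' ⟨i, h⟩ else 0
  have hc : ∑ i ∈ Finset.range k, c i • v i = K.starProjection (v k) := by
    rw [← hc', Finset.sum_range]
    exact Finset.sum_congr rfl fun i _ => by simp [c]
  have horth : ∀ j < k, ⟪v k - ∑ i ∈ Finset.range k, c i • v i, v j⟫ = 0 := by
    intro j hj
    rw [hc]
    exact K.starProjection_inner_eq_zero _ _ (Submodule.subset_span ⟨⟨j, hj⟩, rfl⟩)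
  refine ⟨c, horth, ?_⟩
  set u := ∑ i ∈ Finset.range k, c i • v i with hu
  have h1 : ‖u‖ ^ 2 = ∑ i ∈ Finset.range k, c i * ⟪v k, v i⟫ := by
    have : ⟪v k - u, u⟫ = 0 := by
      nth_rw 2 [hu]
      rw [inner_sum]
      refine Finset.sum_eq_zero fun i hi => ?_
      rw [real_inner_smul_right, horth i (Finset.mem_range.1 hi), mul_zero]
    rw [inner_sub_left, sub_eq_zero, real_inner_self_eq_norm_sq] at this
    rw [← this, hu, inner_sum]
    simp_rw [real_inner_smul_right]
  have hθ0 : 0 ≤ θ := by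
    have : 0 ≤ ∑' d, ρ d := tsum_nonneg fun d => (abs_nonneg _).trans (hρ 0 d)
    linarith
  have hlow := sum_abs_inner_lower_le hρ hs hθ k
  -- With `S` the sum of the `c i ^ 2`, this reads `‖u‖ ^ 2 ≤ θ (S + 1) / 4`. The Riesz bound and `θ
  -- ≤ 1 / 2` give `S ≤ 2 ‖u‖ ^ 2`, which closes the estimate.
  have h2 : ‖u‖ ^ 2 ≤ (θ / 2 * ∑ i ∈ Finset.range k, c i ^ 2 + θ / 2) / 2 := by
    rw [h1]
    calc ∑ i ∈ Finset.range k, c i * ⟪v k, v i⟫ ≤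
        ∑ i ∈ Finset.range k, (c i ^ 2 * (θ / 2) + |⟪v k, v i⟫|) / 2 := by
          refine Finset.sum_le_sum fun i hi => ?_
          have ha : |⟪v k, v i⟫| ≤ θ / 2 :=
            (Finset.single_le_sum (f := fun j => |⟪v k, v j⟫|) (fun _ _ => abs_nonneg _) hi).trans
              hlow
          have hb := le_abs_self (c i * ⟪v k, v i⟫)
          rw [abs_mul] at hb
          have hcc : |c i| ≤ (c i ^ 2 + 1) / 2 := by
            rw [← sq_abs (c i)]
            nlinarith [sq_nonneg (|c i| - 1)]
          have hd := mul_le_mul_of_nonneg_right hcc (abs_nonneg ⟪v k, v i⟫)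
          have he := mul_le_mul_of_nonneg_left ha (sq_nonneg (c i))
          linarith
      _ ≤ _ := by
          rw [← Finset.sum_div, Finset.sum_add_distrib, ← Finset.sum_mul]
          linarith
  have h3 := sum_sq_le_norm_sq hv hρ hs hθ c k
  have h4 : 0 ≤ ∑ i ∈ Finset.range k, c i ^ 2 := Finset.sum_nonneg fun i _ => sq_nonneg _
  rw [← hu] at h3
  nlinarith

end AlmostOrthogonal

/-! ### The lower half of the law. -/

variable {Ω : Type*} [MeasurableSpace Ω] {P : Measure Ω}

/-- The second Borel–Cantelli lemma against the divergent harmonic series, applied to measurable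
modifications because the `W k` are only almost everywhere measurable. -/
theorem ae_frequently_of_iIndepFun [IsProbabilityMeasure P] {W : ℕ → Ω → ℝ}
    (hW : ∀ k, AEMeasurable (W k) P) (hind : iIndepFun W P) {x : ℕ → ℝ} {c : ℝ} (hc : 0 < c)
    (hx : ∀ᶠ k : ℕ in atTop, ENNReal.ofReal (c * (1 / (k : ℝ))) ≤ P {ω | x k ≤ W k ω}) :
    ∀ᵐ ω ∂P, ∃ᶠ k in atTop, x k ≤ W k ω := by
  let s : ℕ → Set Ω := fun k => (hW k).mk (W k) ⁻¹' Set.Ici (x k)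
  have hsm : ∀ k, MeasurableSet (s k) := fun k => (hW k).measurable_mk measurableSet_Ici
  have hind' : iIndepFun (fun k => (hW k).mk (W k)) P := hind.congr fun k => (hW k).ae_eq_mk
  have hs : iIndepSet s P := by
    rw [iIndepSet_iff_meas_biInter hsm]
    intro S
    exact hind'.measure_inter_preimage_eq_mul S (sets := fun k => Set.Ici (x k))
      fun k _ => measurableSet_Ici
  have hPs : ∀ k, P (s k) = P {ω | x k ≤ W k ω} := by
    intro k
    refine measure_congr (eventuallyEq_set.2 ?_)
    filter_upwards [(hW k).ae_eq_mk] with ω hω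
    simp [s, hω]
  have htop : ∑' k, P (s k) = ∞ := by
    by_contra hne
    have hsum := ENNReal.summable_toReal hne
    have : Summable fun k : ℕ => c * (1 / (k : ℝ)) := by
      refine Summable.of_norm_bounded_eventually_nat hsum ?_
      filter_upwards [hx] with k hk
      rw [Real.norm_of_nonneg (by positivity), hPs]
      exact (ENNReal.ofReal_le_iff_le_toReal (measure_ne_top _ _)).1 hk
    rw [summable_mul_left_iff hc.ne'] at this
    exact Real.not_summable_one_div_natCast this
  have hlim := measure_limsup_eq_one hsm hs htop
  have h1 : ∀ᵐ ω ∂P, ω ∈ limsup s atTop :=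
    (mem_ae_iff_prob_eq_one (MeasurableSet.measurableSet_limsup hsm)).2 hlim
  filter_upwards [h1, ae_all_iff.2 fun k => (hW k).ae_eq_mk] with ω hω hmk
  rw [mem_limsup_iff_frequently_mem] at hω
  refine hω.mono fun k hk => ?_
  rw [hmk k]
  exact hk

namespace IsGaussianEmbedding

variable {Z : ℕ → Ω → ℝ} {z : ℕ → H}

/-- Orthogonality means zero covariance, which for jointly Gaussian variables is independence. -/
theorem iIndepFun_of_orthogonal [IsProbabilityMeasure P] (hZ : IsGaussianEmbedding P Z z)
    {w : ℕ → ℕ →₀ ℝ}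
    (hw : ∀ i j, i ≠ j → ⟪Finsupp.linearCombination ℝ z (w i),
      Finsupp.linearCombination ℝ z (w j)⟫ = 0) :
    iIndepFun (fun k => Finsupp.linearCombination ℝ Z (w k)) P := by
  have hm : ∀ k, AEMeasurable (Finsupp.linearCombination ℝ Z (w k)) P := fun k =>
    hZ.gaussian.aemeasurable (w k)
  have h := IsGaussianProcess.iIndepFun_of_covariance_eq_zero (S := fun _ : ℕ => Unit) (P := P)
    (X := fun k _ => Finsupp.linearCombination ℝ Z (w k))
    (hZ.gaussian.comp_right fun p : (_ : ℕ) × Unit => w p.1) (fun k _ => hm k)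
    (fun i j hij _ _ => by
      rw [covariance_eq_sub (hZ.gaussian.hasGaussianLaw_eval _).memLp_two
        (hZ.gaussian.hasGaussianLaw_eval _).memLp_two, hZ.centered, zero_mul, sub_zero]
      exact (hZ.inner_eq _ _).trans (hw i j hij))
  exact h.comp (fun _ f => f ()) fun _ => measurable_pi_apply _

/-- Absorbs the `+ 1` of the Gaussian lower tail, so that the probability at level `s * √(2 * log
k)` is at least a constant times `1 / k`. -/
theorem eventually_sq_add_one_le {s : ℝ} (hs0 : 0 ≤ s) (hs : s < 1) :
    ∀ᶠ k : ℕ in atTop, (s * √(2 * Real.log k) + 1) ^ 2 ≤ 2 * Real.log k := by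
  have hlog : Tendsto (fun k : ℕ => √(2 * Real.log k)) atTop atTop :=
    Real.tendsto_sqrt_atTop.comp
      ((Real.tendsto_log_atTop.comp tendsto_natCast_atTop_atTop).const_mul_atTop two_pos)
  filter_upwards [hlog.eventually_ge_atTop (1 / (1 - s))] with k hk
  rw [div_le_iff₀ (by linarith)] at hk
  have h0 : 0 ≤ 2 * Real.log k := mul_nonneg zero_le_two (Real.log_natCast_nonneg k)
  calc _ ≤ (√(2 * Real.log k)) ^ 2 := by
        refine pow_le_pow_left₀ (by positivity) ?_ 2
        linarith
    _ = _ := Real.sq_sqrt h0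

/-- The lower half of the law of the iterated logarithm for an almost orthonormal sequence. -/
theorem ae_frequently_of_almost_orthonormal [IsProbabilityMeasure P]
    (hZ : IsGaussianEmbedding P Z z) {y : ℕ → ℕ →₀ ℝ} {ρ : ℕ → ℝ} {τ s : ℝ}
    (hy : ∀ i, ‖Finsupp.linearCombination ℝ z (y i)‖ = 1)
    (hρ : ∀ i d, |⟪Finsupp.linearCombination ℝ z (y i),
      Finsupp.linearCombination ℝ z (y (i + d + 1))⟫| ≤ ρ d)
    (hsum : Summable ρ) (hτ0 : 0 < τ) (hτ : τ ≤ 1 / 2) (hθ : ∑' d, ρ d ≤ τ ^ 2 / 2)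
    (hs0 : 0 ≤ s) (hs : s < 1) :
    ∀ᵐ ω ∂P, ∃ᶠ k : ℕ in atTop,
      (s - 3 * τ) * √(2 * Real.log k) ≤ Finsupp.linearCombination ℝ Z (y k) ω := by
  set v : ℕ → H := fun i => Finsupp.linearCombination ℝ z (y i) with hvdef
  -- Gram–Schmidt with `θ = τ ^ 2`: the projections `u k` have norm at most `τ`, and the residuals
  -- `w k` are mutually orthogonal.
  choose c hc hcn using exists_coeff_orthogonal (v := v) hy hρ hsum hθ (by nlinarith)
  let u : ℕ → ℕ →₀ ℝ := fun k => ∑ i ∈ Finset.range k, c k i • y i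
  let w : ℕ → ℕ →₀ ℝ := fun k => y k - u k
  have hu : ∀ k, Finsupp.linearCombination ℝ z (u k) = ∑ i ∈ Finset.range k, c k i • v i := by
    intro k
    simp [u, v, map_sum]
  have hw : ∀ k, Finsupp.linearCombination ℝ z (w k) =
      v k - ∑ i ∈ Finset.range k, c k i • v i := by
    intro k
    simp only [w, map_sub, hu, v]
  have hlt : ∀ i j, i < j → ⟪Finsupp.linearCombination ℝ z (w j),
      Finsupp.linearCombination ℝ z (w i)⟫ = 0 := by
    intro i j hij
    rw [hw j, hw i, inner_sub_right, hc j i hij, inner_sum, Finset.sum_eq_zero, sub_zero]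
    intro l hl
    rw [real_inner_smul_right, hc j l ((Finset.mem_range.1 hl).trans hij), mul_zero]
  have hind := hZ.iIndepFun_of_orthogonal (w := w) fun i j hij => by
    rcases hij.lt_or_gt with h | h
    · rw [real_inner_comm]
      exact hlt i j h
    · exact hlt j i h
  have hun : ∀ k, ‖Finsupp.linearCombination ℝ z (u k)‖ ≤ τ := fun k => by
    rw [hu]
    exact le_of_sq_le_sq (hcn k) hτ0.le
  have hwn : ∀ k, 1 - τ ≤ ‖Finsupp.linearCombination ℝ z (w k)‖ := fun k => by
    have h1 := norm_sub_norm_le (v k) (Finsupp.linearCombination ℝ z (u k))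
    rw [hy k] at h1
    have h2 : Finsupp.linearCombination ℝ z (w k) = v k - Finsupp.linearCombination ℝ z (u k) := by
      rw [hw, hu]
    rw [h2]
    linarith [hun k]
  have hW := ae_frequently_of_iIndepFun (fun k => hZ.gaussian.aemeasurable (w k)) hind
    (x := fun k => s * √(2 * Real.log k) * ‖Finsupp.linearCombination ℝ z (w k)‖)
    (c := (√(2 * Real.pi))⁻¹) (by positivity) (by
      filter_upwards [eventually_sq_add_one_le hs0 hs, eventually_ge_atTop 1] with k hk hk1
      refine le_trans (ENNReal.ofReal_le_ofReal ?_) (hZ.le_measure_le (w k)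
        (by linarith [hwn k]) (by positivity))
      have hk0 : (0 : ℝ) < k := by exact_mod_cast hk1
      gcongr
      rw [one_div, ← Real.exp_log (inv_pos.2 hk0), Real.log_inv]
      exact Real.exp_le_exp.2 (by linarith))
  -- The extra factor `√2` makes the tail `2 / k ^ 2`, summable without independence of the
  -- projections.
  have hU : ∀ᵐ ω ∂P, ∀ᶠ k : ℕ in atTop, ω ∉ {ω | √2 * √(2 * Real.log k) *
      ‖Finsupp.linearCombination ℝ z (u k)‖ < |Finsupp.linearCombination ℝ Z (u k) ω|} := by
    refine ae_eventually_notMem_of_summable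
      ((Real.summable_one_div_nat_pow.2 one_lt_two).mul_left 2) ?_
    filter_upwards [eventually_ge_atTop 1] with k hk1
    refine (hZ.measure_lt_abs_le (u k) (by positivity)).trans (ENNReal.ofReal_le_ofReal ?_)
    have hk0 : (0 : ℝ) < k := by exact_mod_cast hk1
    have hl : 0 ≤ 2 * Real.log k := mul_nonneg zero_le_two (Real.log_natCast_nonneg k)
    rw [mul_pow, Real.sq_sqrt zero_le_two, Real.sq_sqrt hl, one_div,
      ← Real.exp_log (inv_pos.2 (pow_pos hk0 2)), Real.log_inv, Real.log_pow]
    gcongr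
    push_cast
    linarith
  filter_upwards [hW, hU] with ω hω hω'
  refine (hω.and_eventually hω').mono fun k ⟨h1, h2⟩ => ?_
  simp only [not_lt] at h2
  have h3 : Finsupp.linearCombination ℝ Z (y k) ω =
      Finsupp.linearCombination ℝ Z (w k) ω + Finsupp.linearCombination ℝ Z (u k) ω := by
    simp [w]
  have h4 := neg_le_of_abs_le h2
  set R := √(2 * Real.log k)
  have hR : 0 ≤ R := Real.sqrt_nonneg _
  have h5 : √2 * R * ‖Finsupp.linearCombination ℝ z (u k)‖ ≤ 2 * R * τ := by
    gcongr
    · exact Real.sqrt_le_iff.2 ⟨by norm_num, by norm_num⟩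
    · exact hun k
  have h6 : s * R * (1 - τ) ≤ s * R * ‖Finsupp.linearCombination ℝ z (w k)‖ := by
    gcongr
    exact hwn k
  rw [h3]
  -- The residual loses `s * τ ≤ τ` and the projection at most `2 * τ`, in units of `R`.
  nlinarith [mul_nonneg hR hτ0.le]

end IsGaussianEmbedding

/-- Along a geometric subsequence, `log log` of the time is at most `log k` plus a constant. -/
theorem eventually_log_log_le_mul_log {c : ℝ} (hc : 1 < c) (m D : ℕ) :
    ∀ᶠ k : ℕ in atTop, Real.log (Real.log ((2 ^ (m + D * k) : ℕ) : ℝ)) ≤ c * Real.log k := by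
  have hlog : Tendsto (fun k : ℕ => Real.log k) atTop atTop :=
    Real.tendsto_log_atTop.comp tendsto_natCast_atTop_atTop
  filter_upwards [hlog.eventually_ge_atTop (Real.log (m + D + 1) / (c - 1)),
    eventually_ge_atTop 2] with k hk hk1
  rw [div_le_iff₀ (by linarith)] at hk
  have hk0 : (1 : ℝ) ≤ k := by exact_mod_cast (by omega : 1 ≤ k)
  have hl2 := Real.log_pos one_lt_two
  have hl2' : Real.log 2 ≤ 1 := by linarith [Real.log_two_lt_d9]
  push_cast
  rw [Real.log_pow]
  rcases Nat.eq_zero_or_pos (m + D * k) with h0 | h0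
  · rw [h0]
    simp only [Nat.cast_zero, zero_mul, Real.log_zero]
    have := Real.log_natCast_nonneg k
    positivity
  · have h0' : (0 : ℝ) < ((m + D * k : ℕ) : ℝ) := by exact_mod_cast h0
    calc Real.log (((m + D * k : ℕ) : ℝ) * Real.log 2) ≤ Real.log ((m + D + 1) * k) := by
          refine Real.log_le_log (by positivity) ?_
          calc ((m + D * k : ℕ) : ℝ) * Real.log 2 ≤ ((m + D * k : ℕ) : ℝ) * 1 := by gcongr
            _ ≤ _ := by
              push_cast
              have : (0 : ℝ) ≤ m := m.cast_nonneg
              nlinarith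
      _ = Real.log (m + D + 1) + Real.log k := Real.log_mul (by positivity) (by positivity)
      _ ≤ _ := by linarith

/-- The lower half of the law of the iterated logarithm. -/
theorem IsGaussianEmbedding.ae_frequently_le [IsProbabilityMeasure P] {Z : ℕ → Ω → ℝ} {z : ℕ → H}
    (hZ : IsGaussianEmbedding P Z z) (hz : ∀ i j k, ⟪z (i + k), z (j + k)⟫ = ⟪z i, z j⟫) {a : ℝ}
    (hg : IsRegVarNorm (fun n => ‖windowSum z 0 n‖) a) (ha : 0 < a) (ha' : a < 1) {τ : ℝ}
    (hτ0 : 0 < τ) (hτ : τ ≤ 1 / 4) :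
    ∀ᵐ ω ∂P, ∃ᶠ n : ℕ in atTop, (1 - 5 * τ) * (√(2 * Real.log (Real.log n)) *
      ‖windowSum z 0 n‖) ≤ windowSum (fun i => Z i ω) 0 n := by
  obtain ⟨κ, C, p₀, hκ, hκ1, hC, hpos, hcor⟩ := exists_abs_inner_dyadic_le hz hg ha ha'
  have hlim : Tendsto (fun l : ℕ => C / (1 - κ) * κ ^ l) atTop (𝓝 0) := by
    simpa using (tendsto_pow_atTop_nhds_zero_of_lt_one hκ.le hκ1).const_mul (C / (1 - κ))
  obtain ⟨l, hl, hl1⟩ := ((hlim.eventually_lt_const (show 0 < τ ^ 2 / 2 by positivity)).and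
    (eventually_ge_atTop 1)).exists
  -- The exponent step is even because the decorrelation bound compares exponents `p` and `p + 2 *
  -- d`; here `d` is a multiple of `l`, and a large `l` makes the total correlation small.
  let N : ℕ → ℕ := fun k => 2 ^ (p₀ + 2 * l * k)
  have hN : ∀ k, 0 < ‖windowSum z 0 (N k)‖ := fun k => hpos _ (by omega)
  let y : ℕ → ℕ →₀ ℝ := fun k => ‖windowSum z 0 (N k)‖⁻¹ • windowCoeff 0 (N k)
  have hyz : ∀ k, Finsupp.linearCombination ℝ z (y k) =
      ‖windowSum z 0 (N k)‖⁻¹ • windowSum z 0 (N k) := fun k => by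
    simp only [y, map_smul, linearCombination_windowCoeff]
  let ρ : ℕ → ℝ := fun d => C * κ ^ l * κ ^ d
  have hsum : HasSum ρ (C * κ ^ l * (1 - κ)⁻¹) :=
    (hasSum_geometric_of_lt_one hκ.le hκ1).mul_left _
  have hy1 : ∀ i, ‖Finsupp.linearCombination ℝ z (y i)‖ = 1 := fun i => by
    rw [hyz, norm_smul, norm_inv, norm_norm, inv_mul_cancel₀ (hN i).ne']
  have hρ : ∀ i d, |⟪Finsupp.linearCombination ℝ z (y i),
      Finsupp.linearCombination ℝ z (y (i + d + 1))⟫| ≤ ρ d := by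
    intro i d
    have h := hcor (p₀ + 2 * l * i) (by omega) (l * (d + 1))
    have e : p₀ + 2 * l * i + 2 * (l * (d + 1)) = p₀ + 2 * l * (i + d + 1) := by ring
    rw [e] at h
    change |⟪windowSum z 0 (N i), windowSum z 0 (N (i + d + 1))⟫| ≤
      C * κ ^ (l * (d + 1)) * (‖windowSum z 0 (N i)‖ * ‖windowSum z 0 (N (i + d + 1))‖) at h
    have h1 := hN i
    have h2 := hN (i + d + 1)
    rw [hyz, hyz, real_inner_smul_left, real_inner_smul_right, ← mul_assoc, ← mul_inv, abs_mul,
      abs_of_pos (by positivity), inv_mul_le_iff₀ (by positivity)]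
    refine h.trans ?_
    rw [mul_comm]
    refine mul_le_mul_of_nonneg_left ?_ (by positivity)
    simp only [ρ]
    rw [mul_assoc, ← pow_add]
    refine mul_le_mul_of_nonneg_left ?_ hC.le
    -- The exponents satisfy `l + d ≤ l * (d + 1)` because `l ≥ 1`.
    refine pow_le_pow_of_le_one hκ.le hκ1.le ?_
    nlinarith
  have hmain := hZ.ae_frequently_of_almost_orthonormal (y := y) (s := 1 - τ) hy1 hρ hsum.summable
    hτ0 (by linarith) (by
      rw [hsum.tsum_eq]
      refine le_trans (le_of_eq ?_) hl.le
      rw [div_eq_mul_inv]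
      ring) (by linarith) (by linarith)
  have hc : 1 < (1 + τ) ^ 2 := by nlinarith
  have hNt : Tendsto N atTop atTop := by
    refine (tendsto_pow_atTop_atTop_of_one_lt one_lt_two).comp ?_
    refine tendsto_atTop_mono (fun k => ?_) tendsto_id
    simp only [id]
    nlinarith
  filter_upwards [hmain] with ω hω
  refine hNt.frequently ((hω.and_eventually
    (eventually_log_log_le_mul_log hc p₀ (2 * l))).mono fun k ⟨h1, h2⟩ => ?_)
  have hX : Finsupp.linearCombination ℝ Z (y k) ω =
      ‖windowSum z 0 (N k)‖⁻¹ * windowSum (fun i => Z i ω) 0 (N k) := by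
    simp only [y, map_smul, linearCombination_windowCoeff, Pi.smul_apply, smul_eq_mul,
      windowSum_apply]
  rw [hX, le_inv_mul_iff₀ (hN k)] at h1
  refine le_trans ?_ h1
  have h3 : √(2 * Real.log (Real.log (N k))) ≤ (1 + τ) * √(2 * Real.log k) := by
    calc √(2 * Real.log (Real.log (N k))) ≤ √((1 + τ) ^ 2 * (2 * Real.log k)) :=
          Real.sqrt_le_sqrt (by linarith)
      _ = _ := by rw [Real.sqrt_mul (by positivity), Real.sqrt_sq (by positivity)]
  rw [← mul_assoc, mul_comm]
  refine mul_le_mul_of_nonneg_left ?_ (hN k).le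
  set R := √(2 * Real.log k)
  set R' := √(2 * Real.log (Real.log (N k)))
  have hR : 0 ≤ R := Real.sqrt_nonneg _
  have hR' : 0 ≤ R' := Real.sqrt_nonneg _
  -- The available factor is `(1 - τ) - 3 * τ = 1 - 4 * τ ≥ 0`, and `(1 - 5 * τ) * (1 + τ) ≤ 1 - 4 *
  -- τ`; if `1 - 5 * τ ≤ 0`, signs alone decide.
  rcases le_or_gt (1 - 5 * τ) 0 with h5 | h5
  · nlinarith
  · nlinarith [mul_nonneg hR hτ0.le]

end

section

variable {Ω : Type*} [MeasurableSpace Ω] {P : Measure Ω} {Z : ℕ → Ω → ℝ}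

theorem partialSum_eq_windowSum {Ω : Type*} (Z : ℕ → Ω → ℝ) (n : ℕ) (ω : Ω) :
    partialSum Z n ω = windowSum (fun i => Z i ω) 0 n := by
  simp [partialSum, windowSum]

/-! ### The law for a Gaussian embedding, and criteria for regular variation. -/

section Hilbert

variable {H : Type*} [NormedAddCommGroup H] [InnerProductSpace ℝ H] {z : ℕ → H}

theorem IsGaussianEmbedding.stdDev_eq (hZ : IsGaussianEmbedding P Z z) (n : ℕ) :
    stdDev P Z n = ‖windowSum z 0 n‖ := by
  have h := hZ.integral_sq (windowCoeff 0 n)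
  simp only [linearCombination_windowCoeff, windowSum_apply] at h
  simp only [stdDev, partialSum_eq_windowSum, sq]
  rw [h, Real.sqrt_sq (norm_nonneg _)]

/-- The law of the iterated logarithm, for a regularly varying sequence of norms. -/
theorem IsGaussianEmbedding.lil [IsProbabilityMeasure P] (hZ : IsGaussianEmbedding P Z z)
    (hz : ∀ i j k, ⟪z (i + k), z (j + k)⟫ = ⟪z i, z j⟫) {a : ℝ}
    (hg : IsRegVarNorm (fun n => ‖windowSum z 0 n‖) a) (ha : 0 < a) (ha' : a < 1) :
    LIL P Z := by
  -- A countable family of tolerances, so that the exceptional null sets can be united.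
  let ε : ℕ → ℝ := fun m => 1 / ((m : ℝ) + 1)
  have hε0 : ∀ m, 0 < ε m := fun m => by positivity
  have hε1 : ∀ m, ε m ≤ 1 := fun m => by
    have : (0 : ℝ) ≤ m := m.cast_nonneg
    exact (div_le_one (by positivity)).2 (by linarith)
  have hεt : Tendsto ε atTop (𝓝 0) := tendsto_one_div_add_atTop_nhds_zero_nat
  have hgrid := ae_all_iff.2 fun m => ae_all_iff.2 fun l => hZ.ae_eventually_grid l (hε0 m)
  have hlow := ae_all_iff.2 fun m => hZ.ae_frequently_le hz hg ha ha' (τ := ε m / 4)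
    (by have := hε0 m; positivity) (by linarith [hε1 m])
  have hlog : ∀ᶠ n : ℕ in atTop, 0 < Real.log (Real.log n) :=
    (Real.tendsto_log_atTop.comp (Real.tendsto_log_atTop.comp
      tendsto_natCast_atTop_atTop)).eventually_gt_atTop 0
  have hden : ∀ᶠ n : ℕ in atTop, √(2 * stdDev P Z n ^ 2 * Real.log (Real.log n)) =
      √(2 * Real.log (Real.log n)) * ‖windowSum z 0 n‖ ∧
        0 < √(2 * Real.log (Real.log n)) * ‖windowSum z 0 n‖ := by
    filter_upwards [hlog, hg.eventually_pos] with n hn hgn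
    refine ⟨?_, by positivity⟩
    rw [hZ.stdDev_eq, mul_right_comm, Real.sqrt_mul (by positivity), Real.sqrt_sq (norm_nonneg _)]
  filter_upwards [hgrid, hlow, hZ.ae_eventually_dyadic hz] with ω h1 h2 h3
  refine le_antisymm ?_ ?_
  · rw [← EReal.le_of_forall_lt_iff_le]
    intro c hc
    have hc : (1 : ℝ) < c := by exact_mod_cast hc
    have hlim : Tendsto (fun m => (1 + ε m) ^ 3) atTop (𝓝 1) := by
      simpa using (hεt.const_add 1).pow 3
    obtain ⟨m, hm⟩ := (hlim.eventually_lt_const hc).exists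
    refine limsup_le_of_le (by isBoundedDefault) ?_
    filter_upwards [hg.eventually_windowSum_le ha ha' (hε0 m) h3 (h1 m), hden] with n hn ⟨hd, hd0⟩
    rw [EReal.coe_le_coe_iff, hd, div_le_iff₀ hd0, partialSum_eq_windowSum]
    refine hn.trans ?_
    gcongr
  · rw [← EReal.ge_of_forall_gt_iff_ge]
    intro c hc
    have hc : c < (1 : ℝ) := by exact_mod_cast hc
    have hlim : Tendsto (fun m => 1 - 5 * (ε m / 4)) atTop (𝓝 1) := by
      simpa using ((hεt.div_const 4).const_mul 5).const_sub 1
    obtain ⟨m, hm⟩ := (hlim.eventually_const_lt hc).exists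
    refine le_limsup_of_frequently_le (((h2 m).and_eventually hden).mono ?_) (by isBoundedDefault)
    rintro n ⟨hn, hd, hd0⟩
    rw [EReal.coe_le_coe_iff, hd, le_div_iff₀ hd0, partialSum_eq_windowSum]
    refine le_trans ?_ hn
    gcongr

/-- Subadditivity is the triangle inequality together with stationarity; the ratio limit is `j ^ a`
because `L (j * n) / L n → 1`. -/
theorem isRegVarNorm_of_isEquivalent (hz : ∀ i j k, ⟪z (i + k), z (j + k)⟫ = ⟪z i, z j⟫)
    {a : ℝ} {L : ℝ → ℝ} (hL : IsSlowlyVarying L)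
    (h : (fun n => ‖windowSum z 0 n‖) ~[atTop] fun n : ℕ => (n : ℝ) ^ a * L n) :
    IsRegVarNorm (fun n => ‖windowSum z 0 n‖) a := by
  set g : ℕ → ℝ := fun n => ‖windowSum z 0 n‖ with hgdef
  set f : ℕ → ℝ := fun n => (n : ℝ) ^ a * L n with hfdef
  have hcast : Tendsto (fun n : ℕ => (n : ℝ)) atTop atTop := tendsto_natCast_atTop_atTop
  have hLpos : ∀ᶠ n : ℕ in atTop, 0 < L n := hcast.eventually hL.eventually_pos
  have hfpos : ∀ᶠ n : ℕ in atTop, 0 < f n := by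
    filter_upwards [hLpos, eventually_gt_atTop 0] with n hn hn0
    have : (0 : ℝ) < n := by exact_mod_cast hn0
    positivity
  have hgf : Tendsto (fun n => g n / f n) atTop (𝓝 1) :=
    (isEquivalent_iff_tendsto_one (hfpos.mono fun n hn => hn.ne')).1 h
  have hgpos : ∀ᶠ n in atTop, 0 < g n := by
    filter_upwards [hfpos, hgf.eventually_const_lt one_pos] with n hn hn'
    exact (div_pos_iff_of_pos_right hn).1 hn'
  refine ⟨fun n => norm_nonneg _, by simp [hgdef], fun m n => ?_, fun m n => ?_, hgpos,
    fun j hj => ?_⟩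
  · simp only [hgdef]
    rw [windowSum_add, ← norm_windowSum hz (0 + m) n]
    exact norm_add_le _ _
  · simp only [hgdef]
    rw [windowSum_add, ← norm_windowSum hz (0 + m) n]
    exact norm_le_norm_add_norm_sub' _ _ |>.trans (by
      rw [add_comm, norm_sub_rev, add_sub_cancel_left, add_comm])
  · have hj' : (0 : ℝ) < j := by exact_mod_cast hj
    have hmul : Tendsto (fun n : ℕ => j * n) atTop atTop :=
      tendsto_id.const_mul_atTop' hj
    have h1 := (hgf.comp hmul).mul
      (((hL.tendsto_ratio j hj').comp hcast).const_mul ((j : ℝ) ^ a))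
    have h2 := h1.mul (hgf.inv₀ one_ne_zero)
    rw [one_mul, mul_one, inv_one, mul_one] at h2
    refine h2.congr' ?_
    filter_upwards [hfpos, hgpos, hLpos, hmul.eventually hfpos, eventually_gt_atTop 0]
      with n hn hgn hLn hjn hn0
    have hn' : (0 : ℝ) < n := by exact_mod_cast hn0
    have hff : f (j * n) = (j : ℝ) ^ a * (L (j * n) / L n) * f n := by
      simp only [hfdef]
      push_cast
      rw [Real.mul_rpow hj'.le hn'.le]
      field_simp
    simp only [Function.comp_apply, inv_div]
    rw [div_mul_eq_mul_div, div_mul_div_comm, div_eq_div_iff (by positivity) hgn.ne', hff]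
    ring

/-- For summable correlations the variances of the partial sums are asymptotically linear. -/
theorem tendsto_norm_sq_windowSum_div {r : ℕ → ℝ} (hr : ∀ n k, ⟪z n, z (n + k)⟫ = r k)
    (hs : Summable fun k => r (k + 1)) :
    Tendsto (fun n : ℕ => ‖windowSum z 0 n‖ ^ 2 / n) atTop (𝓝 (r 0 + 2 * ∑' k, r (k + 1))) := by
  -- The increments of the variance converge, so their Cesàro means have the same limit.
  have hstep : ∀ n, ‖windowSum z 0 (n + 1)‖ ^ 2 - ‖windowSum z 0 n‖ ^ 2 =
      r 0 + 2 * ∑ k ∈ Finset.range n, r (k + 1) := by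
    intro n
    have h1 : ⟪windowSum z 0 n, z n⟫ = ∑ k ∈ Finset.range n, r (k + 1) := by
      rw [windowSum, sum_inner, ← Finset.sum_range_reflect]
      refine Finset.sum_congr rfl fun i hi => ?_
      have hi := Finset.mem_range.1 hi
      rw [← hr (0 + (n - 1 - i)) (i + 1), show 0 + (n - 1 - i) + (i + 1) = n by omega]
    have h2 : ‖z n‖ ^ 2 = r 0 := by
      rw [← real_inner_self_eq_norm_sq, ← hr n 0, add_zero]
    rw [windowSum_add, norm_add_sq_real]
    simp only [windowSum, zero_add, Finset.range_one, Finset.sum_singleton, add_zero] at h1 ⊢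
    rw [h1, h2]
    ring
  have hlim : Tendsto (fun n : ℕ => r 0 + 2 * ∑ k ∈ Finset.range n, r (k + 1)) atTop
      (𝓝 (r 0 + 2 * ∑' k, r (k + 1))) :=
    (hs.hasSum.tendsto_sum_nat.const_mul 2).const_add (r 0)
  refine hlim.cesaro.congr fun n => ?_
  simp_rw [← hstep]
  rw [Finset.sum_range_sub (fun n => ‖windowSum z 0 n‖ ^ 2)]
  simp [div_eq_inv_mul]

end Hilbert

/-! ### Realization of the sequence in `L²`. -/

namespace IsCenteredStationaryGaussian

theorem memLp (hZ : IsCenteredStationaryGaussian P Z) (i : ℕ) : MemLp (Z i) 2 P :=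
  (hZ.gaussian.hasGaussianLaw_eval i).memLp_two

/-- The variables of the sequence as vectors of `L²`. -/
noncomputable def toL2 (hZ : IsCenteredStationaryGaussian P Z) (i : ℕ) : Lp ℝ 2 P :=
  (hZ.memLp i).toLp (Z i)

theorem coeFn_linearCombination_toL2 (hZ : IsCenteredStationaryGaussian P Z) (c : ℕ →₀ ℝ) :
    (Finsupp.linearCombination ℝ hZ.toL2 c : Lp ℝ 2 P) =ᵐ[P] Finsupp.linearCombination ℝ Z c := by
  induction c using Finsupp.induction_linear with
  | zero =>
    simp only [map_zero]
    exact Lp.coeFn_zero _ _ _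
  | add c d hc hd =>
    simp only [map_add]
    exact (Lp.coeFn_add _ _).trans (hc.add hd)
  | single i r =>
    simp only [Finsupp.linearCombination_single]
    exact (Lp.coeFn_smul _ _).trans ((hZ.memLp i).coeFn_toLp.const_smul r)

theorem isGaussianEmbedding (hZ : IsCenteredStationaryGaussian P Z) :
    IsGaussianEmbedding P Z hZ.toL2 where
  gaussian := by
    refine hZ.gaussian.of_isGaussianProcess fun c => ⟨c.support,
      ∑ i : c.support, c i • ContinuousLinearMap.proj (R := ℝ) i, fun ω => ?_⟩
    rw [Finsupp.linearCombination_apply, Finsupp.sum, Finset.sum_apply, ← Finset.sum_coe_sort]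
    simp
  centered c := by
    rw [Finsupp.linearCombination_apply, Finsupp.sum]
    simp only [Finset.sum_apply, Pi.smul_apply, smul_eq_mul]
    rw [integral_finsetSum _ fun i _ =>
      ((hZ.gaussian.hasGaussianLaw_eval i).integrable.const_mul _)]
    simp [integral_const_mul, hZ.centered]
  inner_eq c d := by
    rw [L2.inner_def]
    refine integral_congr_ae ?_
    filter_upwards [hZ.coeFn_linearCombination_toL2 c, hZ.coeFn_linearCombination_toL2 d]
      with ω hc hd
    rw [hc, hd]
    simp [mul_comm]

theorem inner_toL2 (hZ : IsCenteredStationaryGaussian P Z) (n k : ℕ) :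
    ⟪hZ.toL2 n, hZ.toL2 (n + k)⟫ = corr P Z k := by
  have h := hZ.isGaussianEmbedding.inner_eq (Finsupp.single n 1) (Finsupp.single (n + k) 1)
  simp only [Finsupp.linearCombination_single, one_smul] at h
  rw [← h, hZ.stationary]

theorem inner_toL2_shift (hZ : IsCenteredStationaryGaussian P Z) (i j k : ℕ) :
    ⟪hZ.toL2 (i + k), hZ.toL2 (j + k)⟫ = ⟪hZ.toL2 i, hZ.toL2 j⟫ := by
  have h : ∀ i d k, ⟪hZ.toL2 (i + k), hZ.toL2 (i + d + k)⟫ = ⟪hZ.toL2 i, hZ.toL2 (i + d)⟫ := by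
    intro i d k
    rw [add_right_comm, hZ.inner_toL2, hZ.inner_toL2]
  rcases le_total i j with hij | hij
  · obtain ⟨d, rfl⟩ := Nat.exists_eq_add_of_le hij
    exact h i d k
  · obtain ⟨d, rfl⟩ := Nat.exists_eq_add_of_le hij
    rw [real_inner_comm, h, real_inner_comm]

/-- Regular variation of the standard deviations of the partial sums, with an index in `(0, 1)`,
suffices for the law of the iterated logarithm. -/
theorem lil_of_isEquivalent [IsProbabilityMeasure P] (hZ : IsCenteredStationaryGaussian P Z)
    {a : ℝ} {L : ℝ → ℝ} (ha : 0 < a) (ha' : a < 1) (hL : IsSlowlyVarying L)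
    (h : stdDev P Z ~[atTop] fun n : ℕ => (n : ℝ) ^ a * L n) : LIL P Z := by
  have hE := hZ.isGaussianEmbedding
  have hg : stdDev P Z = fun n => ‖windowSum hZ.toL2 0 n‖ := funext hE.stdDev_eq
  rw [hg] at h
  exact hE.lil hZ.inner_toL2_shift (isRegVarNorm_of_isEquivalent hZ.inner_toL2_shift hL h) ha ha'

/-- Square root of the linear variance asymptotics: regular variation of index `1 / 2` with a
constant slowly varying factor. -/
theorem stdDev_isEquivalent_sqrt (hZ : IsCenteredStationaryGaussian P Z)
    (hs : Summable fun k : ℕ => |corr P Z k|)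
    (hpos : 0 < corr P Z 0 + 2 * ∑' k : ℕ, corr P Z (k + 1)) :
    stdDev P Z ~[atTop] fun n : ℕ => (n : ℝ) ^ (1 / 2 : ℝ) *
      √(corr P Z 0 + 2 * ∑' k : ℕ, corr P Z (k + 1)) := by
  set σ := corr P Z 0 + 2 * ∑' k : ℕ, corr P Z (k + 1)
  have hE := hZ.isGaussianEmbedding
  have hlim := tendsto_norm_sq_windowSum_div hZ.inner_toL2
    ((summable_nat_add_iff 1).2 hs.of_abs)
  have hsqrt := ((Real.continuous_sqrt.tendsto σ).comp hlim).div_const √σ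
  rw [div_self (Real.sqrt_pos.2 hpos).ne'] at hsqrt
  refine (isEquivalent_iff_tendsto_one ?_).2 (hsqrt.congr fun n => ?_)
  · filter_upwards [eventually_gt_atTop 0] with n hn
    have : (0 : ℝ) < n := by exact_mod_cast hn
    have := Real.sqrt_pos.2 hpos
    positivity
  · simp only [Function.comp_apply, Pi.div_apply]
    rw [hE.stdDev_eq, Real.sqrt_div (sq_nonneg _), Real.sqrt_sq (norm_nonneg _), div_div,
      ← Real.sqrt_eq_rpow]

end IsCenteredStationaryGaussian

theorem isSlowlyVarying_const {c : ℝ} (hc : 0 < c) : IsSlowlyVarying fun _ => c where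
  measurable := measurable_const
  eventually_pos := Eventually.of_forall fun _ => hc
  tendsto_ratio := fun _ _ => by simp [div_self hc.ne']

end

end GaussianLIL

theorem mainTheorem6 {Ω : Type*} [MeasurableSpace Ω] (P : Measure Ω) [IsProbabilityMeasure P]
    (Z : ℕ → Ω → ℝ) (hZ : GaussianLIL.IsCenteredStationaryGaussian P Z) :
    (∀ (a : ℝ) (L : ℝ → ℝ), 0 < a → a < 1 → GaussianLIL.IsSlowlyVarying L →
      (GaussianLIL.stdDev P Z ~[atTop] fun n : ℕ => (n : ℝ) ^ a * L (n : ℝ)) →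
      (GaussianLIL.corr P Z =O[atTop] fun k : ℕ => (k : ℝ) ^ (-(2 - 2 * a))) →
      GaussianLIL.LIL P Z) ∧
    ((Summable fun k : ℕ => |GaussianLIL.corr P Z k|) →
      (0 < GaussianLIL.corr P Z 0 + 2 * ∑' k : ℕ, GaussianLIL.corr P Z (k + 1) ∨
        ∃ (a : ℝ) (L : ℝ → ℝ), 0 < a ∧ a < 1 ∧ GaussianLIL.IsSlowlyVarying L ∧
          (GaussianLIL.stdDev P Z ~[atTop] fun n : ℕ => (n : ℝ) ^ a * L (n : ℝ))) →
      GaussianLIL.LIL P Z) := by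
  refine ⟨fun a L ha ha' hL h _ => hZ.lil_of_isEquivalent ha ha' hL h, fun hs h => ?_⟩
  rcases h with hpos | ⟨a, L, ha, ha', hL, h⟩
  · exact hZ.lil_of_isEquivalent (by norm_num) (by norm_num)
      (GaussianLIL.isSlowlyVarying_const (Real.sqrt_pos.2 hpos))
      (hZ.stdDev_isEquivalent_sqrt hs hpos)
  · exact hZ.lil_of_isEquivalent ha ha' hL h
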